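/- Let $S^5\to\mathbb{C}P^2$ be the Hopf fibration, $Z\cdot\overline W=\sum_k z_k\overline{w_k}$ on $\mathbb{C}^3$, $z=x+iy\in\mathbb{C}$. Let $f:\mathbb{C}\to\mathbb{C}P^2$ be a smooth conformal minimal Lagrangian immersion with induced metric $2e^{u}\,dz\,d\bar z$ (Fubini–Study metric of holomorphic sectional curvature $4$), which is translationally equivariant: $f(t+z)=R(t)f(z)$ for all $t\in\mathbb{R}$, $z\in\mathbb{C}$, with a one-parameter subgroup $R$ of $SU(3)$. Let $\lambda\in S^1$ and write the Hopf differential $(F_{zz}\cdot\overline{F_{\bar z}})\,dz^3$ of $f$ ($F$ a horizontal lift to $S^5$) as $-i\lambda^{-3}\psi\,dz^3$. Assume that $f$ is neither totally geodesic nor flat, that is, $\psi\not\equiv0$ and $u$ is not constant, that the origin is chosen so that $u$ attains its maximum at $0$, and that the cubic form $\lambda^{-3}\psi$ is real. Then $\psi$ is constant. Put $$a_1=e^{u(0)},\quad \beta=2a_1+\frac{|\psi|^2}{a_1^2},\quad s=\frac{\beta}{2}-a_1,\quad a_2=\frac{s+\sqrt{s^2+4a_1s}}{2},\quad a_3=\frac{-s+\sqrt{s^2+4a_1s}}{2},$$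 $$k=\sqrt{\frac{a_1-a_2}{a_1+a_3}},\quad r=\sqrt{2(a_1+a_3)},\quad T=\frac{K(k)}{r},\qquad d_1=\frac{\lambda^{-3}\psi}{a_1},\quad d_2=\frac{\lambda^{-3}\psi}{a_2},\quad d_3=-\frac{\lambda^{-3}\psi}{a_3},$$ $$c_1=a_1\sqrt{\frac{a_1-a_2}{a_1^3-|\psi|^2}},\quad c_2=a_2\sqrt{\frac{a_1-a_2}{|\psi|^2-a_2^3}},\quad c_3=a_3\sqrt{\frac{a_1+a_3}{|\psi|^2+a_3^3}},$$ where $K(k)=\int_0^{\pi/2}(1-k^2\sin^2\alpha)^{-1/2}d\alpha$ and $\mathrm{sn},\mathrm{cn},\mathrm{dn}$ denote the Jacobi elliptic functions. Let $$D(\lambda)=\begin{pmatrix}0&-i\lambda\bar\psi a_1^{-1}&i\lambda^{-1}a_1^{1/2}\\-i\lambda^{-1}\psi a_1^{-1}&0&i\lambda a_1^{1/2}\\ i\lambda a_1^{1/2}&i\lambda^{-1}a_1^{1/2}&0\end{pmatrix}.$$ The canonical horizontal lift of $f$ is $F=\mathbb{F}e_3$, where $\mathbb{F}:\mathbb{C}\to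 SU(3)$ is smooth with $\mathbb{F}(0)=I$, $$\mathbb{F}^{-1}\mathbb{F}_z=\begin{pmatrix}\frac{u_z}{2}&0&i\lambda^{-1}e^{u/2}\\-i\lambda^{-1}\psi e^{-u}&-\frac{u_z}{2}&0\\0&i\lambda^{-1}e^{u/2}&0\end{pmatrix},\qquad \mathbb{F}^{-1}\mathbb{F}_{\bar z}=\begin{pmatrix}-\frac{u_{\bar z}}{2}&-i\lambda\bar\psi e^{-u}&0\\0&\frac{u_{\bar z}}{2}&i\lambda e^{u/2}\\i\lambda e^{u/2}&0&0\end{pmatrix},$$ and $f=A[F]$ for some $A\in SU(3)$ (that is, $f=[F]$ up to an isometry of $\mathbb{C}P^2$). **Theorem.** The canonical horizontal lift exists, and there is an orthonormal basis $l_1,l_2,l_3$ of $\mathbb{C}^3$ with $D(\lambda)l_j=id_jl_j$ such that for all $x,y\in\mathbb{R}$ $$F(x,y)=c_1\,\mathrm{sn}(ry,k)\,e^{id_1x}\,l_1+c_2\,\mathrm{cn}(ry,k)\,e^{id_2x}\,l_2+c_3\,\mathrm{dn}(ry,k)\,e^{id_3x}\,l_3 .$$ It satisfies $F(x,y+4T)=F(x,y)$.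 In particular $T>0$ and $f$ descends to the cylinder $\mathbb{C}/4Ti\mathbb{Z}$. If a real number $\tau\neq0$ satisfies $f(x+\tau,y)=f(x,y)$ for all $x,y$, then $e^{id_1\tau}=e^{id_2\tau}=e^{id_3\tau}$, and $f$ descends to the torus $\mathbb{C}/(4Ti\mathbb{Z}+\tau\mathbb{Z})$ (the numbers $4Ti$ and $\tau$ being linearly independent over $\mathbb{R}$). Such a $\tau$ exists if and only if $d_1/d_2$ is rational. -/

import Mathlib

open scoped Matrix ContDiff LinearAlgebra.Projectivization

namespace MinLag

noncomputable section

/-- `∂/∂z = (∂/∂x - i ∂/∂y) / 2` on functions of `z = x + i y`. -/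
def dz {E : Type*} [NormedAddCommGroup E] [NormedSpace ℂ E] (G : ℂ → E) (z : ℂ) : E :=
  (1 / 2 : ℂ) • (fderiv ℝ G z 1 - Complex.I • fderiv ℝ G z Complex.I)

/-- `∂/∂z̄ = (∂/∂x + i ∂/∂y) / 2` on functions of `z = x + i y`. -/
def dzbar {E : Type*} [NormedAddCommGroup E] [NormedSpace ℂ E] (G : ℂ → E) (z : ℂ) : E :=
  (1 / 2 : ℂ) • (fderiv ℝ G z 1 + Complex.I • fderiv ℝ G z Complex.I)

/-- The flat Laplacian `∂²/∂x² + ∂²/∂y²`. -/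
def flatLaplacian {E : Type*} [NormedAddCommGroup E] [NormedSpace ℝ E] (G : ℂ → E) (z : ℂ) : E :=
  fderiv ℝ (fun w => fderiv ℝ G w 1) z 1 + fderiv ℝ (fun w => fderiv ℝ G w Complex.I) z Complex.I

/-- The Hermitian product `Z · W̄ = ∑ Z_k conj(W_k)` on `ℂ³`. -/
def herm (Z W : Fin 3 → ℂ) : ℂ := Z ⬝ᵥ star W

/-- The complex projective plane. -/
abbrev CP2 : Type := ℙ ℂ (Fin 3 → ℂ)

/-- `F : ℂ → S⁵ ⊂ ℂ³` is a smooth lift of `f`, horizontal for the Hopf fibration `S⁵ → ℂP²`. -/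
structure IsHorizontalLift (f : ℂ → CP2) (F : ℂ → Fin 3 → ℂ) : Prop where
  smooth : ContDiff ℝ ∞ F
  unit : ∀ z, herm (F z) (F z) = 1
  lift : ∀ z, ∃ h : F z ≠ 0, Projectivization.mk ℂ (F z) h = f z
  horizontal_z : ∀ z, herm (dz F z) (F z) = 0
  horizontal_zbar : ∀ z, herm (dzbar F z) (F z) = 0

/-- `f : ℂ → ℂP²` is a smooth conformal minimal Lagrangian immersion with induced metric
`2 e^u dz dz̄` (for the Fubini-Study metric of holomorphic sectional curvature `4`) and cubic Hopf
differential `φ dz³`. As `ℂ` is simply connected, a smooth immersion `f` is Lagrangian exactly when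
it has a (global) horizontal lift `F`, which is then unique up to a constant phase. Since
`S⁵ → ℂP²` is a Riemannian submersion, the metric, the mean curvature and the Hopf differential
of `f` are computed from `F`. Here `F` spans the fibre direction, the normal space of `f` at `f z`
is identified with the vectors `n` that are Hermitian orthogonal to `F z` and real orthogonal to
`F_x`, `F_y`, and the mean curvature vector is `e^{-u}/4` times the component of `F_xx + F_yy` in
this space. -/
def IsConformalMinimalLagrangian (f : ℂ → CP2) (u : ℂ → ℝ) (φ : ℂ → ℂ) : Prop :=
  ∃ F : ℂ → Fin 3 → ℂ, IsHorizontalLift f F ∧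
    -- conformality, with induced metric `2 e^u dz dz̄`
    (∀ z, herm (dz F z) (dz F z) = (Real.exp (u z) : ℂ)) ∧
    (∀ z, herm (dzbar F z) (dzbar F z) = (Real.exp (u z) : ℂ)) ∧
    (∀ z, herm (dz F z) (dzbar F z) = 0) ∧
    -- minimality: the mean curvature vector vanishes
    (∀ z, ∀ n : Fin 3 → ℂ, herm n (F z) = 0 → (herm n (fderiv ℝ F z 1)).re = 0 →
      (herm n (fderiv ℝ F z Complex.I)).re = 0 → (herm (flatLaplacian F z) n).re = 0) ∧
    -- Hopf differential
    (∀ z, φ z = herm (dz (dz F) z) (dzbar F z))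

/-- The elements of `SU(3)`, acting on `ℂP²` through Mathlib's action of `SL(3, ℂ)`. -/
def IsSU3 (A : Matrix.SpecialLinearGroup (Fin 3) ℂ) : Prop :=
  (A : Matrix (Fin 3) (Fin 3) ℂ) ∈ Matrix.unitaryGroup (Fin 3) ℂ

/-- `f(t + z) = R(t) f(z)` for a one-parameter subgroup `R` of `SU(3)`. -/
def IsTranslationallyEquivariant (f : ℂ → CP2) : Prop :=
  ∃ R : ℝ → Matrix.SpecialLinearGroup (Fin 3) ℂ,
    (∀ t, IsSU3 (R t)) ∧
    Continuous (fun t => (R t : Matrix (Fin 3) (Fin 3) ℂ)) ∧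
    (∀ s t, R (s + t) = R s * R t) ∧
    ∀ (t : ℝ) (z : ℂ), f (t + z) = R t • f z

/-- `λ⁻¹ U₋₁ + U₀`. -/
def frameU (u : ℂ → ℝ) (ψ : ℂ → ℂ) (lam z : ℂ) : Matrix (Fin 3) (Fin 3) ℂ :=
  lam⁻¹ • !![0, 0, Complex.I * Real.exp (u z / 2);
             -Complex.I * ψ z * Real.exp (-u z), 0, 0;
             0, Complex.I * Real.exp (u z / 2), 0] +
  !![dz (fun w => (u w : ℂ)) z / 2, 0, 0;
     0, -dz (fun w => (u w : ℂ)) z / 2, 0;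
     0, 0, 0]

/-- `λ V₁ + V₀`. -/
def frameV (u : ℂ → ℝ) (ψ : ℂ → ℂ) (lam z : ℂ) : Matrix (Fin 3) (Fin 3) ℂ :=
  lam • !![0, -Complex.I * star (ψ z) * Real.exp (-u z), 0;
           0, 0, Complex.I * Real.exp (u z / 2);
           Complex.I * Real.exp (u z / 2), 0, 0] +
  !![-dzbar (fun w => (u w : ℂ)) z / 2, 0, 0;
     0, dzbar (fun w => (u w : ℂ)) z / 2, 0;
     0, 0, 0]

/-- `Φ : ℂ → SU(3)` is the extended frame at `λ` of the data `(u, ψ)`, normalized by `Φ(0) = I`: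
`Φ⁻¹ Φ_z = λ⁻¹ U₋₁ + U₀` and `Φ⁻¹ Φ_z̄ = λ V₁ + V₀`. -/
structure IsExtendedFrame (u : ℂ → ℝ) (ψ : ℂ → ℂ) (lam : ℂ)
    (Φ : ℂ → Matrix (Fin 3) (Fin 3) ℂ) : Prop where
  mem : ∀ z, Φ z ∈ Matrix.specialUnitaryGroup (Fin 3) ℂ
  smooth : ∀ i j, ContDiff ℝ ∞ (fun z => Φ z i j)
  eq_z : ∀ z i j, dz (fun w => Φ w i j) z = (Φ z * frameU u ψ lam z) i j
  eq_zbar : ∀ z i j, dzbar (fun w => Φ w i j) z = (Φ z * frameV u ψ lam z) i j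
  init : Φ 0 = 1

/-- `F = Φ e₃`, the third column of the normalized extended frame `Φ`, where `f = [F]` up to an
isometry `A ∈ SU(3)` of `ℂP²`. -/
def IsCanonicalLift (f : ℂ → CP2) (u : ℂ → ℝ) (ψ : ℂ → ℂ) (lam : ℂ)
    (F : ℂ → Fin 3 → ℂ) : Prop :=
  (∃ Φ, IsExtendedFrame u ψ lam Φ ∧ ∀ z i, F z i = Φ z i 2) ∧
  ∃ A : Matrix.SpecialLinearGroup (Fin 3) ℂ, IsSU3 A ∧
    ∀ z, ∃ h : F z ≠ 0, f z = A • (Projectivization.mk ℂ (F z) h : CP2)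

/-- The generating matrix `D(λ)`, where `a₁ = e^{u(0)}` and `p` is the value of `ψ`. -/
def potentialD (a₁ : ℝ) (p lam : ℂ) : Matrix (Fin 3) (Fin 3) ℂ :=
  !![0, -Complex.I * lam * star p / a₁, Complex.I * lam⁻¹ * Real.sqrt a₁;
     -Complex.I * lam⁻¹ * p / a₁, 0, Complex.I * lam * Real.sqrt a₁;
     Complex.I * lam * Real.sqrt a₁, Complex.I * lam⁻¹ * Real.sqrt a₁, 0]

/-- The elliptic integral of the first kind `∫₀^θ dα / √(1 - k² sin² α)`. -/
def ellipticJ (θ k : ℝ) : ℝ := ∫ α in (0 : ℝ)..θ, 1 / Real.sqrt (1 - k ^ 2 * Real.sin α ^ 2)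

/-- The complete elliptic integral of the first kind. -/
def ellipticK (k : ℝ) : ℝ := ellipticJ (Real.pi / 2) k

/-- The Jacobi amplitude, the inverse function of `θ ↦ ellipticJ θ k` (a bijection of `ℝ` for
`0 ≤ k < 1`). -/
def jacobiAm (x k : ℝ) : ℝ := Function.invFun (fun θ => ellipticJ θ k) x

def jacobiSn (x k : ℝ) : ℝ := Real.sin (jacobiAm x k)

def jacobiCn (x k : ℝ) : ℝ := Real.cos (jacobiAm x k)

def jacobiDn (x k : ℝ) : ℝ := Real.sqrt (1 - k ^ 2 * Real.sin (jacobiAm x k) ^ 2)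

/-- `f` factors through the quotient map `ℂ → ℂ / L`. -/
def DescendsTo (f : ℂ → CP2) (L : AddSubgroup ℂ) : Prop :=
  ∃ g : ℂ ⧸ L → CP2, ∀ z : ℂ, g (QuotientAddGroup.mk z) = f z

end

end MinLag

/-! A horizontal lift F together with F_z and F_z̄ is an orthogonal moving frame of ℂ³. Conformality
and minimality fix its derivatives: F_zz̄ = -e^u F and F_zz = u_z F_z + φ e^{-u} F_z̄, with φ =
-iλ⁻³ψ. Equality of mixed third derivatives (`integrability`) is the Codazzi equation φ_z̄ = 0
together with the Gauss equation u_zz̄ = |φ|² e^{-2u} - e^u. A real holomorphic function is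
constant, hence so is ψ.

Equivariance makes u a function of y alone (`metric_translate_eq`), and the Gauss equation becomes
an ODE. Its energy integral says that w = e^u satisfies w'² = -8 (w - a₁)(w - a₂)(w + a₃), so w = a₁
- (a₁ - a₂) sn²(ry, k) (`exp_eq_jacobi`). Nonconstancy of u forces |ψ|² < a₁³, that is, a₂ < a₁.

The normalized unitary frame Φ solves a linear system whose coefficients are invariant under real
translations. Uniqueness (`frame_unique`) gives Φ(t + z) = Φ(t) Φ(z), so F_x = D F with D
skew-Hermitian. Inserting this into F_xx + F_yy = -4 e^u F, the component of F(iy) along an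
eigenvector of D with eigenvalue i d solves h'' = (d² - 4w) h. This is a Lamé equation, and for d =
d₁, d₂, d₃ it is solved by sn, cn, dn; the values of F and F_y at the origin fix the coefficients
(`explicit_col`).

The vertical period is the common period 4K of sn, cn, dn. A real period of f multiplies F by a
scalar; at a height where all three components are nonzero this forces the three characters e^{i d_j
τ} to agree. As d₁ + d₂ + d₃ = 0, a nonzero such τ exists exactly when d₁/d₂ is rational. -/

namespace MinLag

/-! ### Wirtinger calculus. -/

section Calculus

variable {E : Type*} [NormedAddCommGroup E] [NormedSpace ℂ E]

theorem fderiv_eq_dz_add_dzbar (G : ℂ → E) (z : ℂ) :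
    fderiv ℝ G z 1 = dz G z + dzbar G z := by
  unfold dz dzbar; module

theorem fderiv_I_eq_dz_sub_dzbar (G : ℂ → E) (z : ℂ) :
    fderiv ℝ G z Complex.I = Complex.I • (dz G z - dzbar G z) := by
  have h : Complex.I • (dz G z - dzbar G z)
      = -(Complex.I * Complex.I) • fderiv ℝ G z Complex.I := by
    unfold dz dzbar; module
  rw [h, Complex.I_mul_I]; simp

theorem fderiv_eq_zero_of_dz_dzbar {G : ℂ → E} {z : ℂ} (h1 : dz G z = 0) (h2 : dzbar G z = 0) :
    fderiv ℝ G z = 0 := by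
  have e1 := fderiv_eq_dz_add_dzbar G z
  have e2 := fderiv_I_eq_dz_sub_dzbar G z
  rw [h1, h2] at e1 e2
  ext v
  have hv : v = v.re • (1 : ℂ) + v.im • Complex.I := by
    apply Complex.ext <;> simp
  rw [hv, map_add, map_smul, map_smul, e1, e2]
  simp

theorem eq_of_dz_dzbar_eq_zero {G : ℂ → E} (hG : Differentiable ℝ G)
    (h1 : ∀ z, dz G z = 0) (h2 : ∀ z, dzbar G z = 0) (z w : ℂ) : G z = G w :=
  is_const_of_fderiv_eq_zero hG (fun z => fderiv_eq_zero_of_dz_dzbar (h1 z) (h2 z)) z w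

theorem contDiff_fderiv_apply {E : Type*} [NormedAddCommGroup E] [NormedSpace ℝ E]
    {G : ℂ → E} (hG : ContDiff ℝ ∞ G) (v : ℂ) :
    ContDiff ℝ ∞ (fun z => fderiv ℝ G z v) :=
  ((contDiff_infty_iff_fderiv.1 hG).2).clm_apply contDiff_const

theorem contDiff_dz {G : ℂ → E} (hG : ContDiff ℝ ∞ G) : ContDiff ℝ ∞ (dz G) :=
  ((contDiff_fderiv_apply hG 1).sub ((contDiff_fderiv_apply hG Complex.I).const_smul _)).const_smul _

theorem contDiff_dzbar {G : ℂ → E} (hG : ContDiff ℝ ∞ G) : ContDiff ℝ ∞ (dzbar G) :=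
  ((contDiff_fderiv_apply hG 1).add ((contDiff_fderiv_apply hG Complex.I).const_smul _)).const_smul _

theorem dz_smul {g : ℂ → ℂ} {G : ℂ → E} {z : ℂ} (hg : DifferentiableAt ℝ g z)
    (hG : DifferentiableAt ℝ G z) :
    dz (fun w => g w • G w) z = dz g z • G z + g z • dz G z := by
  unfold dz
  rw [fderiv_fun_smul hg hG]
  simp only [_root_.add_apply, _root_.smul_apply,
    ContinuousLinearMap.smulRight_apply, smul_eq_mul]
  module

theorem dzbar_smul {g : ℂ → ℂ} {G : ℂ → E} {z : ℂ} (hg : DifferentiableAt ℝ g z)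
    (hG : DifferentiableAt ℝ G z) :
    dzbar (fun w => g w • G w) z = dzbar g z • G z + g z • dzbar G z := by
  unfold dzbar
  rw [fderiv_fun_smul hg hG]
  simp only [_root_.add_apply, _root_.smul_apply,
    ContinuousLinearMap.smulRight_apply, smul_eq_mul]
  module

theorem dz_mul {g h : ℂ → ℂ} {z : ℂ} (hg : DifferentiableAt ℝ g z)
    (hh : DifferentiableAt ℝ h z) :
    dz (fun w => g w * h w) z = dz g z * h z + g z * dz h z := dz_smul hg hh

theorem dzbar_mul {g h : ℂ → ℂ} {z : ℂ} (hg : DifferentiableAt ℝ g z)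
    (hh : DifferentiableAt ℝ h z) :
    dzbar (fun w => g w * h w) z = dzbar g z * h z + g z * dzbar h z := dzbar_smul hg hh

theorem dz_add {G H : ℂ → E} {z : ℂ} (hG : DifferentiableAt ℝ G z)
    (hH : DifferentiableAt ℝ H z) : dz (fun w => G w + H w) z = dz G z + dz H z := by
  unfold dz
  rw [fderiv_fun_add hG hH]
  simp only [_root_.add_apply]
  module

theorem dzbar_add {G H : ℂ → E} {z : ℂ} (hG : DifferentiableAt ℝ G z)
    (hH : DifferentiableAt ℝ H z) : dzbar (fun w => G w + H w) z = dzbar G z + dzbar H z := by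
  unfold dzbar
  rw [fderiv_fun_add hG hH]
  simp only [_root_.add_apply]
  module

theorem dz_const (c : E) (z : ℂ) : dz (fun _ => c) z = 0 := by simp [dz]

theorem dzbar_const (c : E) (z : ℂ) : dzbar (fun _ => c) z = 0 := by simp [dzbar]

theorem dz_const_smul {G : ℂ → E} {z : ℂ} (c : ℂ) (hG : DifferentiableAt ℝ G z) :
    dz (fun w => c • G w) z = c • dz G z := by
  rw [dz_smul (differentiableAt_const c) hG, dz_const, zero_smul, zero_add]

theorem dzbar_const_smul {G : ℂ → E} {z : ℂ} (c : ℂ) (hG : DifferentiableAt ℝ G z) :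
    dzbar (fun w => c • G w) z = c • dzbar G z := by
  rw [dzbar_smul (differentiableAt_const c) hG, dzbar_const, zero_smul, zero_add]

theorem dz_comm {G : ℂ → E} (hG : ContDiff ℝ ∞ G) (z : ℂ) :
    dzbar (dz G) z = dz (dzbar G) z := by
  have hs : ∀ v, fderiv ℝ (fun w => fderiv ℝ G w v) z = (fderiv ℝ (fderiv ℝ G) z).flip v := by
    intro v
    have h := ((contDiff_infty_iff_fderiv.1 hG).2.differentiable (by simp) z).hasFDerivAt
    have := h.clm_apply (hasFDerivAt_const v z)
    rw [this.fderiv]; ext; simp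
  have h1 := (contDiff_fderiv_apply hG 1).differentiable (by simp) z
  have hI := (contDiff_fderiv_apply hG Complex.I).differentiable (by simp) z
  have sym : fderiv ℝ (fderiv ℝ G) z 1 Complex.I = fderiv ℝ (fderiv ℝ G) z Complex.I 1 :=
    ((contDiff_infty.1 hG 2).contDiffAt.isSymmSndFDerivAt (by simp)).eq 1 Complex.I
  have e1 : fderiv ℝ (dz G) z = (1 / 2 : ℂ) • (fderiv ℝ (fun w => fderiv ℝ G w 1) z -
      Complex.I • fderiv ℝ (fun w => fderiv ℝ G w Complex.I) z) := by
    show fderiv ℝ (fun w => (1 / 2 : ℂ) • (fderiv ℝ G w 1 - Complex.I • fderiv ℝ G w Complex.I)) z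
      = _
    rw [fderiv_fun_const_smul (h1.fun_sub (hI.fun_const_smul _)), fderiv_fun_sub h1 (hI.fun_const_smul _),
      fderiv_fun_const_smul hI]
  have e2 : fderiv ℝ (dzbar G) z = (1 / 2 : ℂ) • (fderiv ℝ (fun w => fderiv ℝ G w 1) z +
      Complex.I • fderiv ℝ (fun w => fderiv ℝ G w Complex.I) z) := by
    show fderiv ℝ (fun w => (1 / 2 : ℂ) • (fderiv ℝ G w 1 + Complex.I • fderiv ℝ G w Complex.I)) z
      = _
    rw [fderiv_fun_const_smul (h1.fun_add (hI.fun_const_smul _)), fderiv_fun_add h1 (hI.fun_const_smul _),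
      fderiv_fun_const_smul hI]
  unfold dzbar at e2 ⊢
  unfold dz at e1 ⊢
  rw [e1, e2]
  simp only [hs, _root_.smul_apply, _root_.sub_apply,
    _root_.add_apply, ContinuousLinearMap.flip_apply, sym]
  module

theorem flatLaplacian_eq {G : ℂ → E} (hG : ContDiff ℝ ∞ G) (z : ℂ) :
    flatLaplacian G z = (4 : ℂ) • dzbar (dz G) z := by
  have hz := (contDiff_dz hG).differentiable (by simp) z
  have hb := (contDiff_dzbar hG).differentiable (by simp) z
  unfold flatLaplacian
  have e1 : (fun w => fderiv ℝ G w 1) = fun w => dz G w + dzbar G w :=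
    funext fun w => fderiv_eq_dz_add_dzbar G w
  have e2 : (fun w => fderiv ℝ G w Complex.I) = fun w => Complex.I • (dz G w - dzbar G w) :=
    funext fun w => fderiv_I_eq_dz_sub_dzbar G w
  rw [e1, e2, fderiv_fun_add hz hb, fderiv_fun_const_smul (hz.fun_sub hb), fderiv_fun_sub hz hb]
  simp only [_root_.smul_apply, _root_.sub_apply,
    _root_.add_apply, fderiv_eq_dz_add_dzbar, fderiv_I_eq_dz_sub_dzbar, dz_comm hG]
  have : ∀ a b c d : E, a + b + (c + d) + Complex.I • (Complex.I • (a - b) - Complex.I • (c - d))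
    = a + b + (c + d) + (Complex.I * Complex.I) • ((a - b) - (c - d)) := by
    intros; module
  rw [this, Complex.I_mul_I]
  module

end Calculus

/-! ### Coordinates, conjugation and the Hermitian product. -/

section Components

theorem fderiv_apply_coord {G : ℂ → Fin 3 → ℂ} {z : ℂ} (hG : DifferentiableAt ℝ G z) (v : ℂ)
    (j : Fin 3) : fderiv ℝ G z v j = fderiv ℝ (fun w => G w j) z v := by
  have := (hasFDerivAt_pi'.1 hG.hasFDerivAt j).fderiv
  rw [this]; rfl

theorem dz_apply {G : ℂ → Fin 3 → ℂ} {z : ℂ} (hG : DifferentiableAt ℝ G z) (j : Fin 3) :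
    dz G z j = dz (fun w => G w j) z := by
  simp [dz, fderiv_apply_coord hG]

theorem dzbar_apply {G : ℂ → Fin 3 → ℂ} {z : ℂ} (hG : DifferentiableAt ℝ G z) (j : Fin 3) :
    dzbar G z j = dzbar (fun w => G w j) z := by
  simp [dzbar, fderiv_apply_coord hG]

theorem dz_ofReal_comp {g : ℝ → ℝ} {g' : ℝ} {u : ℂ → ℝ} {z : ℂ} (hg : HasDerivAt g g' (u z))
    (hu : DifferentiableAt ℝ u z) :
    dz (fun w => (g (u w) : ℂ)) z = g' * dz (fun w => (u w : ℂ)) z := by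
  have h1 := (Complex.ofRealCLM.hasFDerivAt.comp z (hg.hasFDerivAt.comp z hu.hasFDerivAt)).fderiv
  have h2 := (Complex.ofRealCLM.hasFDerivAt.comp z hu.hasFDerivAt).fderiv
  unfold dz
  erw [h1, h2]
  simp
  ring

theorem dzbar_ofReal_comp {g : ℝ → ℝ} {g' : ℝ} {u : ℂ → ℝ} {z : ℂ} (hg : HasDerivAt g g' (u z))
    (hu : DifferentiableAt ℝ u z) :
    dzbar (fun w => (g (u w) : ℂ)) z = g' * dzbar (fun w => (u w : ℂ)) z := by
  have h1 := (Complex.ofRealCLM.hasFDerivAt.comp z (hg.hasFDerivAt.comp z hu.hasFDerivAt)).fderiv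
  have h2 := (Complex.ofRealCLM.hasFDerivAt.comp z hu.hasFDerivAt).fderiv
  unfold dzbar
  erw [h1, h2]
  simp
  ring

theorem fderiv_star_apply {g : ℂ → ℂ} {z : ℂ} (hg : DifferentiableAt ℝ g z) (v : ℂ) :
    fderiv ℝ (fun w => star (g w)) z v = star (fderiv ℝ g z v) := by
  have h := (Complex.conjCLE.toContinuousLinearMap.hasFDerivAt.comp z hg.hasFDerivAt).fderiv
  erw [h]
  simp

theorem differentiableAt_star {g : ℂ → ℂ} {z : ℂ} (hg : DifferentiableAt ℝ g z) :
    DifferentiableAt ℝ (fun w => star (g w)) z :=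
  (Complex.conjCLE.toContinuousLinearMap.hasFDerivAt.comp z hg.hasFDerivAt).differentiableAt

theorem contDiff_star {g : ℂ → ℂ} (hg : ContDiff ℝ ∞ g) : ContDiff ℝ ∞ (fun w => star (g w)) :=
  Complex.conjCLE.toContinuousLinearMap.contDiff.comp hg

theorem dz_star {g : ℂ → ℂ} {z : ℂ} (hg : DifferentiableAt ℝ g z) :
    dz (fun w => star (g w)) z = star (dzbar g z) := by
  simp only [dz, dzbar, fderiv_star_apply hg]
  simp [sub_eq_add_neg]

theorem dzbar_star {g : ℂ → ℂ} {z : ℂ} (hg : DifferentiableAt ℝ g z) :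
    dzbar (fun w => star (g w)) z = star (dz g z) := by
  simp only [dz, dzbar, fderiv_star_apply hg]
  simp

theorem star_dz_ofReal {u : ℂ → ℝ} {z : ℂ} (hu : DifferentiableAt ℝ u z) :
    star (dz (fun w => (u w : ℂ)) z) = dzbar (fun w => (u w : ℂ)) z := by
  have h := dzbar_star (g := fun w => (u w : ℂ)) (z := z)
    (Complex.ofRealCLM.hasFDerivAt.comp z hu.hasFDerivAt).differentiableAt
  rw [← h]; simp

theorem herm_eq (Z W : Fin 3 → ℂ) :
    herm Z W = Z 0 * star (W 0) + Z 1 * star (W 1) + Z 2 * star (W 2) := by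
  simp [herm, dotProduct, Fin.sum_univ_three]

theorem herm_add_left (X Y W : Fin 3 → ℂ) : herm (X + Y) W = herm X W + herm Y W := by
  simp only [herm, add_dotProduct]

theorem herm_sub_left (X Y W : Fin 3 → ℂ) : herm (X - Y) W = herm X W - herm Y W := by
  simp only [herm, sub_dotProduct]

theorem herm_smul_left (c : ℂ) (X W : Fin 3 → ℂ) : herm (c • X) W = c * herm X W := by
  simp only [herm, smul_dotProduct, smul_eq_mul]

theorem herm_neg_left (X W : Fin 3 → ℂ) : herm (-X) W = -herm X W := by
  simp only [herm, neg_dotProduct]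

theorem herm_add_right (X Y W : Fin 3 → ℂ) : herm W (X + Y) = herm W X + herm W Y := by
  simp only [herm, star_add, dotProduct_add]

theorem herm_sub_right (X Y W : Fin 3 → ℂ) : herm W (X - Y) = herm W X - herm W Y := by
  simp only [herm, star_sub, dotProduct_sub]

theorem herm_smul_right (c : ℂ) (X W : Fin 3 → ℂ) : herm W (c • X) = star c * herm W X := by
  simp only [herm, star_smul, dotProduct_smul, smul_eq_mul]

theorem star_herm (X Y : Fin 3 → ℂ) : star (herm X Y) = herm Y X := by
  simp only [herm_eq, star_add, star_mul', star_star]; ring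

theorem herm_zero_left (X : Fin 3 → ℂ) : herm 0 X = 0 := by simp [herm]

theorem herm_self_eq_zero {X : Fin 3 → ℂ} (h : herm X X = 0) : X = 0 :=
  by
  have h' : (∑ j, Complex.normSq (X j) : ℝ) = 0 := by
    have : ((∑ j, Complex.normSq (X j) : ℝ) : ℂ) = herm X X := by
      simp [herm_eq, Fin.sum_univ_three, Complex.mul_conj]
    rw [h] at this; exact_mod_cast this
  ext j
  exact Complex.normSq_eq_zero.1
    ((Finset.sum_eq_zero_iff_of_nonneg fun j _ => Complex.normSq_nonneg _).1 h' j (Finset.mem_univ j))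

theorem contDiff_herm {G H : ℂ → Fin 3 → ℂ} (hG : ContDiff ℝ ∞ G) (hH : ContDiff ℝ ∞ H) :
    ContDiff ℝ ∞ (fun w => herm (G w) (H w)) := by
  simp only [herm_eq]
  have a := fun j => contDiff_pi.1 hG j
  have b := fun j => contDiff_star (contDiff_pi.1 hH j)
  exact (((a 0).mul (b 0)).add ((a 1).mul (b 1))).add ((a 2).mul (b 2))

theorem dz_herm {G H : ℂ → Fin 3 → ℂ} {z : ℂ} (hG : DifferentiableAt ℝ G z)
    (hH : DifferentiableAt ℝ H z) :
    dz (fun w => herm (G w) (H w)) z = herm (dz G z) (H z) + herm (G z) (dzbar H z) := by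
  have a := fun j => differentiableAt_pi.1 hG j
  have b := fun j => differentiableAt_star (differentiableAt_pi.1 hH j)
  simp only [herm_eq]
  rw [dz_add (((a 0).fun_mul (b 0)).fun_add ((a 1).fun_mul (b 1))) ((a 2).fun_mul (b 2)),
    dz_add ((a 0).fun_mul (b 0)) ((a 1).fun_mul (b 1)), dz_mul (a 0) (b 0), dz_mul (a 1) (b 1),
    dz_mul (a 2) (b 2)]
  simp only [dz_apply hG, dzbar_apply hH, fun j => dz_star (differentiableAt_pi.1 hH j)]
  ring

theorem dzbar_herm {G H : ℂ → Fin 3 → ℂ} {z : ℂ} (hG : DifferentiableAt ℝ G z)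
    (hH : DifferentiableAt ℝ H z) :
    dzbar (fun w => herm (G w) (H w)) z = herm (dzbar G z) (H z) + herm (G z) (dz H z) := by
  have a := fun j => differentiableAt_pi.1 hG j
  have b := fun j => differentiableAt_star (differentiableAt_pi.1 hH j)
  simp only [herm_eq]
  rw [dzbar_add (((a 0).fun_mul (b 0)).fun_add ((a 1).fun_mul (b 1))) ((a 2).fun_mul (b 2)),
    dzbar_add ((a 0).fun_mul (b 0)) ((a 1).fun_mul (b 1)), dzbar_mul (a 0) (b 0), dzbar_mul (a 1) (b 1),
    dzbar_mul (a 2) (b 2)]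
  simp only [dzbar_apply hG, dz_apply hH, fun j => dzbar_star (differentiableAt_pi.1 hH j)]
  ring

end Components

section Translation

variable {E : Type*} [NormedAddCommGroup E] [NormedSpace ℂ E]

theorem dz_translate (G : ℂ → E) (t z : ℂ) : dz (fun w => G (t + w)) z = dz G (t + z) := by
  unfold dz
  rw [fderiv_comp_add_left]

theorem dzbar_translate (G : ℂ → E) (t z : ℂ) :
    dzbar (fun w => G (t + w)) z = dzbar G (t + z) := by
  unfold dzbar
  rw [fderiv_comp_add_left]

end Translation

/-- A horizontal map `F : ℂ → S⁵` which is conformal with metric `2 e^u dz dz̄`, minimal, and has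
cubic differential `φ dz³`. -/
structure IsMinimalLegendrian (F : ℂ → Fin 3 → ℂ) (u : ℂ → ℝ) (φ : ℂ → ℂ) : Prop where
  smooth : ContDiff ℝ ∞ F
  unit : ∀ z, herm (F z) (F z) = 1
  horizontal_z : ∀ z, herm (dz F z) (F z) = 0
  horizontal_zbar : ∀ z, herm (dzbar F z) (F z) = 0
  metric_z : ∀ z, herm (dz F z) (dz F z) = (Real.exp (u z) : ℂ)
  metric_zbar : ∀ z, herm (dzbar F z) (dzbar F z) = (Real.exp (u z) : ℂ)
  conformal : ∀ z, herm (dz F z) (dzbar F z) = 0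
  minimal : ∀ z, ∀ n : Fin 3 → ℂ, herm n (F z) = 0 → (herm n (fderiv ℝ F z 1)).re = 0 →
    (herm n (fderiv ℝ F z Complex.I)).re = 0 → (herm (flatLaplacian F z) n).re = 0
  hopf : ∀ z, φ z = herm (dz (dz F) z) (dzbar F z)

theorem herm_swap_eq_zero {X Y : Fin 3 → ℂ} (h : herm X Y = 0) : herm Y X = 0 := by
  rw [← star_herm, h, star_zero]

/-- Vectors of `ℂ³` with three nonzero pairwise orthogonal vectors are determined by their
products with these. -/
theorem eq_of_herm_eq {e : Fin 3 → Fin 3 → ℂ} {m : Fin 3 → ℂ} (hm : ∀ i, m i ≠ 0)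
    (he : ∀ i j, herm (e i) (e j) = if i = j then m i else 0) {X Y : Fin 3 → ℂ}
    (h : ∀ i, herm X (e i) = herm Y (e i)) : X = Y := by
  let A : Matrix (Fin 3) (Fin 3) ℂ := Matrix.of e
  have hA : A * Aᴴ = Matrix.diagonal m := by
    ext i j
    have := he i j
    rw [Matrix.diagonal_apply, ← this]
    rfl
  -- The Gram matrix of the `e i` is diagonal with nonzero entries, so `A` is invertible.
  have hdet : IsUnit A.det := by
    have h1 := congrArg Matrix.det hA
    rw [Matrix.det_mul, Matrix.det_diagonal] at h1
    have h2 : ∏ i, m i ≠ 0 := Finset.prod_ne_zero_iff.2 fun i _ => hm i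
    rw [← h1] at h2
    exact isUnit_iff_ne_zero.2 (left_ne_zero_of_mul h2)
  have key : A *ᵥ star X = A *ᵥ star Y := by
    ext i
    have h1 := congrArg star (h i)
    rw [star_herm, star_herm] at h1
    exact h1
  have := Matrix.mulVec_injective_of_isUnit ((Matrix.isUnit_iff_isUnit_det A).2 hdet) key
  exact star_injective this

/-! ### Structure equations and integrability of a minimal Legendrian map. -/

namespace IsMinimalLegendrian

variable {F : ℂ → Fin 3 → ℂ} {u : ℂ → ℝ} {φ : ℂ → ℂ} (h : IsMinimalLegendrian F u φ)
include h

theorem diff : Differentiable ℝ F := h.smooth.differentiable (by simp)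

theorem diff_dz : Differentiable ℝ (dz F) := (contDiff_dz h.smooth).differentiable (by simp)

theorem diff_dzbar : Differentiable ℝ (dzbar F) :=
  (contDiff_dzbar h.smooth).differentiable (by simp)

/-- No regularity of `u` is assumed; it is recovered as the logarithm of |F_z|². -/
theorem smooth_u : ContDiff ℝ ∞ u := by
  have h1 := contDiff_herm (contDiff_dz h.smooth) (contDiff_dz h.smooth)
  have h2 : ContDiff ℝ ∞ (fun z => (herm (dz F z) (dz F z)).re) :=
    Complex.reCLM.contDiff.comp h1
  have h3 : u = fun z => Real.log (herm (dz F z) (dz F z)).re := by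
    funext z
    rw [h.metric_z, Complex.ofReal_re, Real.log_exp]
  rw [h3]
  refine h2.log fun z => ?_
  rw [h.metric_z, Complex.ofReal_re]
  exact (Real.exp_pos _).ne'

theorem diff_u : Differentiable ℝ u := h.smooth_u.differentiable (by simp)

theorem smooth_φ : ContDiff ℝ ∞ φ := by
  rw [show φ = _ from funext h.hopf]
  exact contDiff_herm (contDiff_dz (contDiff_dz h.smooth)) (contDiff_dzbar h.smooth)

/-- F_z, F_z̄, F are nonzero and pairwise orthogonal. Every structure equation below is obtained by
comparing the three products with this frame. -/
theorem ext {z : ℂ} {X Y : Fin 3 → ℂ} (h1 : herm X (dz F z) = herm Y (dz F z))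
    (h2 : herm X (dzbar F z) = herm Y (dzbar F z)) (h3 : herm X (F z) = herm Y (F z)) : X = Y := by
  refine eq_of_herm_eq (e := ![dz F z, dzbar F z, F z])
    (m := ![(Real.exp (u z) : ℂ), (Real.exp (u z) : ℂ), 1]) ?_ ?_ ?_
  · intro i; fin_cases i <;> simp
  · intro i j
    fin_cases i <;> fin_cases j <;>
      simp [h.metric_z, h.metric_zbar, h.unit, h.conformal, h.horizontal_z, h.horizontal_zbar,
        herm_swap_eq_zero (h.conformal z), herm_swap_eq_zero (h.horizontal_z z),
        herm_swap_eq_zero (h.horizontal_zbar z)]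
  · intro i; fin_cases i
    · exact h1
    · exact h2
    · exact h3

theorem dz_exp_u (z : ℂ) : dz (fun w => (Real.exp (u w) : ℂ)) z =
    Real.exp (u z) * dz (fun w => (u w : ℂ)) z :=
  dz_ofReal_comp (Real.hasDerivAt_exp _) (h.diff_u z)

theorem dzbar_exp_u (z : ℂ) : dzbar (fun w => (Real.exp (u w) : ℂ)) z =
    Real.exp (u z) * dzbar (fun w => (u w : ℂ)) z :=
  dzbar_ofReal_comp (Real.hasDerivAt_exp _) (h.diff_u z)

theorem herm_dz_dzbar_F (z : ℂ) : herm (dzbar (dz F) z) (F z) = -(Real.exp (u z) : ℂ) := by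
  have h1 := dzbar_herm (h.diff_dz z) (h.diff z)
  rw [show (fun w => herm (dz F w) (F w)) = fun _ => 0 from funext h.horizontal_z,
    dzbar_const, h.metric_z] at h1
  linear_combination -h1

/-- This is the z̄-derivative of F_z · conj(F_z̄) = 0. -/
theorem herm_mixed_relation (z : ℂ) : herm (dzbar (dz F) z) (dzbar F z) =
    -star (herm (dzbar (dz F) z) (dz F z)) := by
  have h1 := dzbar_herm (h.diff_dz z) (h.diff_dzbar z)
  rw [show (fun w => herm (dz F w) (dzbar F w)) = fun _ => 0 from funext h.conformal,
    dzbar_const, ← dz_comm h.smooth] at h1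
  rw [star_herm]
  linear_combination -h1

/-- The normal space is i times the tangent plane. Testing minimality against i F_x kills the
imaginary part of the product, and against F_z - F_z̄ = -i F_y the real part, because the product
with F_z̄ is minus the conjugate of the product with F_z. -/
theorem herm_mixed_dz (z : ℂ) : herm (dzbar (dz F) z) (dz F z) = 0 := by
  set p := herm (dzbar (dz F) z) (dz F z) with hp
  have hq := h.herm_mixed_relation z
  rw [← hp] at hq
  have c1 := h.conformal z
  have c2 := herm_swap_eq_zero c1
  have hx := fderiv_eq_dz_add_dzbar F z
  have hy := fderiv_I_eq_dz_sub_dzbar F z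
  have m1 := h.minimal z (Complex.I • (dz F z + dzbar F z))
    (by simp [herm_smul_left, herm_add_left, h.horizontal_z, h.horizontal_zbar])
    (by simp [hx, herm_smul_left, herm_add_left, herm_add_right, h.metric_z, h.metric_zbar, c1, c2])
    (by simp [hy, herm_smul_left, herm_add_left, herm_sub_right, herm_smul_right, h.metric_z,
          h.metric_zbar, c1, c2])
  have m2 := h.minimal z (dz F z - dzbar F z)
    (by simp [herm_sub_left, h.horizontal_z, h.horizontal_zbar])
    (by simp [hx, herm_sub_left, herm_add_right, h.metric_z, h.metric_zbar, c1, c2])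
    (by simp [hy, herm_sub_left, herm_sub_right, herm_smul_right, h.metric_z,
          h.metric_zbar, c1, c2])
  rw [flatLaplacian_eq h.smooth, herm_smul_left, herm_smul_right, herm_add_right, ← hp, hq] at m1
  rw [flatLaplacian_eq h.smooth, herm_smul_left, herm_sub_right, ← hp, hq] at m2
  simp at m1 m2
  apply Complex.ext
  · simp; linarith
  · simp; linarith

theorem herm_mixed_dzbar (z : ℂ) : herm (dzbar (dz F) z) (dzbar F z) = 0 := by
  rw [h.herm_mixed_relation, h.herm_mixed_dz]; simp

theorem dzbar_dz_F (z : ℂ) : dzbar (dz F) z = (-(Real.exp (u z)) : ℂ) • F z := by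
  apply h.ext (z := z)
  · rw [h.herm_mixed_dz, herm_smul_left, herm_swap_eq_zero (h.horizontal_z z), mul_zero]
  · rw [h.herm_mixed_dzbar, herm_smul_left, herm_swap_eq_zero (h.horizontal_zbar z), mul_zero]
  · rw [h.herm_dz_dzbar_F, herm_smul_left, h.unit, mul_one]

theorem dz_dz_F (z : ℂ) : dz (dz F) z = dz (fun w => (u w : ℂ)) z • dz F z +
    (φ z * Real.exp (-u z)) • dzbar F z := by
  have hE : (Real.exp (-u z) : ℂ) * Real.exp (u z) = 1 := by
    rw [← Complex.ofReal_mul, ← Real.exp_add]; simp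
  apply h.ext (z := z)
  · have h1 := dz_herm (h.diff_dz z) (h.diff_dz z)
    rw [show (fun w => herm (dz F w) (dz F w)) = _ from funext h.metric_z, h.dz_exp_u,
      ← star_herm (dzbar (dz F) z), h.herm_mixed_dz, star_zero, add_zero] at h1
    rw [← h1, herm_add_left, herm_smul_left, herm_smul_left, h.metric_z,
      herm_swap_eq_zero (h.conformal z)]
    ring
  · rw [← h.hopf, herm_add_left, herm_smul_left, herm_smul_left, h.conformal, h.metric_zbar]
    linear_combination -φ z * hE
  · have h1 := dz_herm (h.diff_dz z) (h.diff z)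
    rw [show (fun w => herm (dz F w) (F w)) = fun _ => 0 from funext h.horizontal_z,
      dz_const, h.conformal, add_zero] at h1
    rw [← h1, herm_add_left, herm_smul_left, herm_smul_left, h.horizontal_z, h.horizontal_zbar]
    ring

theorem dzbar_dzbar_F (z : ℂ) : dzbar (dzbar F) z = dzbar (fun w => (u w : ℂ)) z • dzbar F z +
    (-star (φ z) * Real.exp (-u z)) • dz F z := by
  have hE : (Real.exp (-u z) : ℂ) * Real.exp (u z) = 1 := by
    rw [← Complex.ofReal_mul, ← Real.exp_add]; simp
  apply h.ext (z := z)
  · have h1 := dz_herm (h.diff_dz z) (h.diff_dzbar z)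
    rw [show (fun w => herm (dz F w) (dzbar F w)) = fun _ => 0 from funext h.conformal,
      dz_const, ← h.hopf] at h1
    have h2 : herm (dzbar (dzbar F) z) (dz F z) = -star (φ z) := by
      rw [← star_herm, ← star_neg]; congr 1; linear_combination -h1
    rw [h2, herm_add_left, herm_smul_left, herm_smul_left, h.metric_z,
      herm_swap_eq_zero (h.conformal z)]
    linear_combination star (φ z) * hE
  · have h1 := dzbar_herm (h.diff_dzbar z) (h.diff_dzbar z)
    rw [show (fun w => herm (dzbar F w) (dzbar F w)) = _ from funext h.metric_zbar, h.dzbar_exp_u,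
      ← dz_comm h.smooth, ← star_herm (dzbar (dz F) z), h.herm_mixed_dzbar, star_zero,
      add_zero] at h1
    rw [← h1, herm_add_left, herm_smul_left, herm_smul_left, h.metric_zbar, h.conformal]
    ring
  · have h1 := dzbar_herm (h.diff_dzbar z) (h.diff z)
    rw [show (fun w => herm (dzbar F w) (F w)) = fun _ => 0 from funext h.horizontal_zbar,
      dzbar_const, herm_swap_eq_zero (h.conformal z), add_zero] at h1
    rw [← h1, herm_add_left, herm_smul_left, herm_smul_left, h.horizontal_z, h.horizontal_zbar]
    ring

theorem smooth_u_complex : ContDiff ℝ ∞ (fun w => (u w : ℂ)) :=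
  Complex.ofRealCLM.contDiff.comp h.smooth_u

/-- Compare ∂_z̄ F_zz with ∂_z F_zz̄: the F-terms cancel, and so do the terms with u_z̄. The
remaining coefficient of F_z is the Gauss equation and that of F_z̄ the Codazzi equation. -/
theorem integrability (z : ℂ) :
    (dzbar (dz (fun w => (u w : ℂ))) z - φ z * star (φ z) * Real.exp (-u z) ^ 2) • dz F z +
      (dzbar φ z * Real.exp (-u z)) • dzbar F z = (-Real.exp (u z) : ℂ) • dz F z := by
  have duz := (contDiff_dz h.smooth_u_complex).differentiable (by simp) z
  have dφ := h.smooth_φ.differentiable (by simp) z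
  have dEc : DifferentiableAt ℝ (fun w => (Real.exp (-u w) : ℂ)) z :=
    (Complex.ofRealCLM.hasFDerivAt.comp z
      ((h.diff_u z).neg.exp).hasFDerivAt).differentiableAt
  have dEc' : DifferentiableAt ℝ (fun w => -(Real.exp (u w) : ℂ)) z :=
    (Complex.ofRealCLM.hasFDerivAt.comp z
      ((h.diff_u z).exp).hasFDerivAt).differentiableAt.neg
  have e1 : dzbar (fun w => (Real.exp (-u w) : ℂ)) z =
      -(Real.exp (-u z) : ℂ) * dzbar (fun w => (u w : ℂ)) z := by
    have := dzbar_ofReal_comp (g := fun t => Real.exp (-t)) (u := u) (z := z)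
      ((Real.hasDerivAt_exp _).comp _ (hasDerivAt_neg _)) (h.diff_u z)
    rw [this]; simp
  have e2 : dz (fun w => -(Real.exp (u w) : ℂ)) z =
      -(Real.exp (u z) : ℂ) * dz (fun w => (u w : ℂ)) z := by
    have := dz_ofReal_comp (g := fun t => -Real.exp t) (u := u) (z := z)
      (Real.hasDerivAt_exp _).neg (h.diff_u z)
    simpa using this
  have L : dzbar (dz (dz F)) z = dz (dzbar (dz F)) z := dz_comm (contDiff_dz h.smooth) z
  rw [show dz (dz F) = _ from funext h.dz_dz_F, show dzbar (dz F) = _ from funext h.dzbar_dz_F,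
    dzbar_add (duz.fun_smul (h.diff_dz z)) ((dφ.fun_mul dEc).fun_smul (h.diff_dzbar z)),
    dzbar_smul duz (h.diff_dz z), dzbar_smul (dφ.fun_mul dEc) (h.diff_dzbar z),
    dzbar_mul dφ dEc, dz_smul dEc' (h.diff z), e1, e2, h.dzbar_dz_F, h.dzbar_dzbar_F] at L
  rw [← sub_eq_zero] at L ⊢
  rw [← L]
  module

theorem dzbar_φ (z : ℂ) : dzbar φ z = 0 := by
  have h1 := congrArg (fun X => herm X (dzbar F z)) (h.integrability z)
  simp only [herm_add_left, herm_smul_left, h.conformal, h.metric_zbar] at h1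
  have hE : (Real.exp (-u z) : ℂ) * Real.exp (u z) = 1 := by
    rw [← Complex.ofReal_mul, ← Real.exp_add]; simp
  linear_combination h1 - dzbar φ z * hE

theorem gauss (z : ℂ) : dzbar (dz (fun w => (u w : ℂ))) z =
    (‖φ z‖ ^ 2 * Real.exp (-u z) ^ 2 - Real.exp (u z) : ℝ) := by
  have h1 := congrArg (fun X => herm X (dz F z)) (h.integrability z)
  simp only [herm_add_left, herm_smul_left, herm_swap_eq_zero (h.conformal z), h.metric_z] at h1
  have hE : (Real.exp (u z) : ℂ) ≠ 0 := by
    exact_mod_cast (Real.exp_pos _).ne'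
  have h2 : φ z * star (φ z) = (‖φ z‖ ^ 2 : ℂ) := Complex.mul_conj' _
  rw [h2] at h1
  have h3 := mul_right_cancel₀ hE (show (dzbar (dz (fun w => (u w : ℂ))) z -
    (‖φ z‖ ^ 2 : ℂ) * Real.exp (-u z) ^ 2) * Real.exp (u z) = -Real.exp (u z) * Real.exp (u z) by
      linear_combination h1)
  push_cast at h3 ⊢
  linear_combination h3

end IsMinimalLegendrian

theorem IsConformalMinimalLagrangian.exists_lift {f : ℂ → CP2} {u : ℂ → ℝ} {φ : ℂ → ℂ}
    (hf : IsConformalMinimalLagrangian f u φ) :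
    ∃ F, IsHorizontalLift f F ∧ IsMinimalLegendrian F u φ := by
  obtain ⟨F, hF, h1, h2, h3, h4, h5⟩ := hf
  exact ⟨F, hF, hF.smooth, hF.unit, hF.horizontal_z, hF.horizontal_zbar, h1, h2, h3, h4, h5⟩

/-- Conjugating q_z̄ = 0 gives q_z = 0, because q is its own conjugate. -/
theorem const_of_dzbar_eq_zero_of_im_eq_zero {q : ℂ → ℂ} (hq : Differentiable ℝ q)
    (h : ∀ z, dzbar q z = 0) (him : ∀ z, (q z).im = 0) (z w : ℂ) : q z = q w := by
  have hstar : (fun w => star (q w)) = q := by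
    funext w; exact Complex.conj_eq_iff_im.2 (him w)
  refine eq_of_dz_dzbar_eq_zero hq (fun z => ?_) h z w
  have := dz_star (hq z)
  rw [hstar, h, star_zero] at this
  exact this

theorem IsMinimalLegendrian.psi_const {F : ℂ → Fin 3 → ℂ} {u : ℂ → ℝ} {ψ : ℂ → ℂ} {lam : ℂ}
    (h : IsMinimalLegendrian F u (fun z => -Complex.I * (lam ^ (-3 : ℤ) * ψ z)))
    (hlam : ‖lam‖ = 1) (hreal : ∀ z, (lam ^ (-3 : ℤ) * ψ z).im = 0) (z : ℂ) : ψ z = ψ 0 := by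
  have hl : lam ^ (-3 : ℤ) ≠ 0 := zpow_ne_zero _ (by rintro rfl; simp at hlam)
  have hq : (fun z => lam ^ (-3 : ℤ) * ψ z) =
      fun z => Complex.I • (-Complex.I * (lam ^ (-3 : ℤ) * ψ z)) := by
    funext z; simp [← mul_assoc]
  have hd := h.smooth_φ.differentiable (by simp)
  refine mul_left_cancel₀ hl
    (const_of_dzbar_eq_zero_of_im_eq_zero (q := fun z => lam ^ (-3 : ℤ) * ψ z) ?_ ?_ hreal z 0)
  · rw [hq]; exact fun w => (hd w).fun_const_smul Complex.I
  · intro z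
    rw [hq, dzbar_const_smul _ (hd z), h.dzbar_φ, smul_zero]

theorem dz_sub {E : Type*} [NormedAddCommGroup E] [NormedSpace ℂ E] {G H : ℂ → E} {z : ℂ}
    (hG : DifferentiableAt ℝ G z) (hH : DifferentiableAt ℝ H z) :
    dz (fun w => G w - H w) z = dz G z - dz H z := by
  unfold dz
  rw [fderiv_fun_sub hG hH]
  simp only [_root_.sub_apply]
  module

theorem dzbar_sub {E : Type*} [NormedAddCommGroup E] [NormedSpace ℂ E] {G H : ℂ → E} {z : ℂ}
    (hG : DifferentiableAt ℝ G z) (hH : DifferentiableAt ℝ H z) :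
    dzbar (fun w => G w - H w) z = dzbar G z - dzbar H z := by
  unfold dzbar
  rw [fderiv_fun_sub hG hH]
  simp only [_root_.sub_apply]
  module

/-! ### Wirtinger derivatives of determinants and of constant multiples of matrices. -/

section MatrixValued

variable {Φ : ℂ → Matrix (Fin 3) (Fin 3) ℂ} {z : ℂ}

/-- All three terms have the shape x (y z - v w), so one derivative formula serves for each of them.
-/
theorem det_fin_three_rearranged (A : Matrix (Fin 3) (Fin 3) ℂ) :
    A.det = A 0 0 * (A 1 1 * A 2 2 - A 1 2 * A 2 1) + A 0 1 * (A 1 2 * A 2 0 - A 1 0 * A 2 2) +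
      A 0 2 * (A 1 0 * A 2 1 - A 1 1 * A 2 0) := by
  rw [Matrix.det_fin_three]; ring

/-- Liouville's formula. The frame coefficients are trace free, so it makes the determinant of the
frame constant. -/
theorem dz_det (hd : ∀ i j, DifferentiableAt ℝ (fun w => Φ w i j) z)
    {M : Matrix (Fin 3) (Fin 3) ℂ} (hM : ∀ i j, dz (fun w => Φ w i j) z = (Φ z * M) i j) :
    dz (fun w => (Φ w).det) z = M.trace * (Φ z).det := by
  have d2 : ∀ i j k l, DifferentiableAt ℝ (fun w => Φ w i j * Φ w k l) z :=
    fun i j k l => (hd i j).fun_mul (hd k l)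
  have e : ∀ i j k l m n p q r s, dz
      (fun w => Φ w i j * (Φ w k l * Φ w m n - Φ w p q * Φ w r s)) z =
      (Φ z * M) i j * (Φ z k l * Φ z m n - Φ z p q * Φ z r s) +
      Φ z i j * ((Φ z * M) k l * Φ z m n + Φ z k l * (Φ z * M) m n -
        ((Φ z * M) p q * Φ z r s + Φ z p q * (Φ z * M) r s)) := by
    intros
    rw [dz_mul (hd _ _) ((d2 _ _ _ _).fun_sub (d2 _ _ _ _)), dz_sub (d2 _ _ _ _) (d2 _ _ _ _),
      dz_mul (hd _ _) (hd _ _), dz_mul (hd _ _) (hd _ _)]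
    simp only [hM]
  have d4 : ∀ i j k l m n p q r s, DifferentiableAt ℝ
      (fun w => Φ w i j * (Φ w k l * Φ w m n - Φ w p q * Φ w r s)) z := by
    intros; exact (hd _ _).fun_mul ((d2 _ _ _ _).fun_sub (d2 _ _ _ _))
  simp only [det_fin_three_rearranged]
  rw [dz_add ((d4 _ _ _ _ _ _ _ _ _ _).fun_add (d4 _ _ _ _ _ _ _ _ _ _))
    (d4 _ _ _ _ _ _ _ _ _ _), dz_add (d4 _ _ _ _ _ _ _ _ _ _) (d4 _ _ _ _ _ _ _ _ _ _)]
  simp only [e, Matrix.mul_apply, Fin.sum_univ_three, Matrix.trace_fin_three]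
  ring

theorem dzbar_det (hd : ∀ i j, DifferentiableAt ℝ (fun w => Φ w i j) z)
    {M : Matrix (Fin 3) (Fin 3) ℂ} (hM : ∀ i j, dzbar (fun w => Φ w i j) z = (Φ z * M) i j) :
    dzbar (fun w => (Φ w).det) z = M.trace * (Φ z).det := by
  have d2 : ∀ i j k l, DifferentiableAt ℝ (fun w => Φ w i j * Φ w k l) z :=
    fun i j k l => (hd i j).fun_mul (hd k l)
  have e : ∀ i j k l m n p q r s, dzbar
      (fun w => Φ w i j * (Φ w k l * Φ w m n - Φ w p q * Φ w r s)) z =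
      (Φ z * M) i j * (Φ z k l * Φ z m n - Φ z p q * Φ z r s) +
      Φ z i j * ((Φ z * M) k l * Φ z m n + Φ z k l * (Φ z * M) m n -
        ((Φ z * M) p q * Φ z r s + Φ z p q * (Φ z * M) r s)) := by
    intros
    rw [dzbar_mul (hd _ _) ((d2 _ _ _ _).fun_sub (d2 _ _ _ _)),
      dzbar_sub (d2 _ _ _ _) (d2 _ _ _ _), dzbar_mul (hd _ _) (hd _ _),
      dzbar_mul (hd _ _) (hd _ _)]
    simp only [hM]
  have d4 : ∀ i j k l m n p q r s, DifferentiableAt ℝ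
      (fun w => Φ w i j * (Φ w k l * Φ w m n - Φ w p q * Φ w r s)) z := by
    intros; exact (hd _ _).fun_mul ((d2 _ _ _ _).fun_sub (d2 _ _ _ _))
  simp only [det_fin_three_rearranged]
  rw [dzbar_add ((d4 _ _ _ _ _ _ _ _ _ _).fun_add (d4 _ _ _ _ _ _ _ _ _ _))
    (d4 _ _ _ _ _ _ _ _ _ _), dzbar_add (d4 _ _ _ _ _ _ _ _ _ _) (d4 _ _ _ _ _ _ _ _ _ _)]
  simp only [e, Matrix.mul_apply, Fin.sum_univ_three, Matrix.trace_fin_three]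
  ring

theorem dz_const_mul_matrix (C : Matrix (Fin 3) (Fin 3) ℂ)
    (hd : ∀ i j, DifferentiableAt ℝ (fun w => Φ w i j) z)
    {M : Matrix (Fin 3) (Fin 3) ℂ} (hM : ∀ i j, dz (fun w => Φ w i j) z = (Φ z * M) i j)
    (i j : Fin 3) : dz (fun w => (C * Φ w) i j) z = (C * Φ z * M) i j := by
  have d : ∀ k l i j, DifferentiableAt ℝ (fun w => C k l * Φ w i j) z := fun k l i j =>
    (differentiableAt_const _).fun_mul (hd i j)
  rw [Matrix.mul_assoc, Matrix.mul_apply, Fin.sum_univ_three]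
  have hC : ∀ w, (C * Φ w) i j = C i 0 * Φ w 0 j + C i 1 * Φ w 1 j + C i 2 * Φ w 2 j :=
    fun w => by rw [Matrix.mul_apply, Fin.sum_univ_three]
  simp only [hC]
  rw [dz_add ((d _ _ _ _).fun_add (d _ _ _ _)) (d _ _ _ _), dz_add (d _ _ _ _) (d _ _ _ _)]
  have e : ∀ k l i j, dz (fun w => C k l * Φ w i j) z = C k l * (Φ z * M) i j := fun k l i j => by
    rw [← hM]; exact dz_const_smul (C k l) (hd i j)
  simp only [e]

theorem dzbar_const_mul_matrix (C : Matrix (Fin 3) (Fin 3) ℂ)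
    (hd : ∀ i j, DifferentiableAt ℝ (fun w => Φ w i j) z)
    {M : Matrix (Fin 3) (Fin 3) ℂ} (hM : ∀ i j, dzbar (fun w => Φ w i j) z = (Φ z * M) i j)
    (i j : Fin 3) : dzbar (fun w => (C * Φ w) i j) z = (C * Φ z * M) i j := by
  have d : ∀ k l i j, DifferentiableAt ℝ (fun w => C k l * Φ w i j) z := fun k l i j =>
    (differentiableAt_const _).fun_mul (hd i j)
  rw [Matrix.mul_assoc, Matrix.mul_apply, Fin.sum_univ_three]
  have hC : ∀ w, (C * Φ w) i j = C i 0 * Φ w 0 j + C i 1 * Φ w 1 j + C i 2 * Φ w 2 j :=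
    fun w => by rw [Matrix.mul_apply, Fin.sum_univ_three]
  simp only [hC]
  rw [dzbar_add ((d _ _ _ _).fun_add (d _ _ _ _)) (d _ _ _ _),
    dzbar_add (d _ _ _ _) (d _ _ _ _)]
  have e : ∀ k l i j, dzbar (fun w => C k l * Φ w i j) z = C k l * (Φ z * M) i j :=
    fun k l i j => by rw [← hM]; exact dzbar_const_smul (C k l) (hd i j)
  simp only [e]

end MatrixValued

/-! ### The extended frame and the canonical lift. -/

theorem trace_frameU (u : ℂ → ℝ) (ψ : ℂ → ℂ) (lam z : ℂ) : (frameU u ψ lam z).trace = 0 := by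
  simp [frameU, Matrix.trace_fin_three]; ring

theorem trace_frameV (u : ℂ → ℝ) (ψ : ℂ → ℂ) (lam z : ℂ) : (frameV u ψ lam z).trace = 0 := by
  simp [frameV, Matrix.trace_fin_three]; ring

/-- The unitary frame of a minimal Legendrian map, before normalization at the origin. -/
noncomputable def legendrianFrame (F : ℂ → Fin 3 → ℂ) (u : ℂ → ℝ) (lam z : ℂ) :
    Matrix (Fin 3) (Fin 3) ℂ :=
  Matrix.of fun i => ![(-Complex.I * lam * Real.exp (-u z / 2)) * dz F z i,
    (-Complex.I * lam⁻¹ * Real.exp (-u z / 2)) * dzbar F z i, F z i]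

namespace IsMinimalLegendrian

variable {F : ℂ → Fin 3 → ℂ} {u : ℂ → ℝ} {ψ : ℂ → ℂ} {lam : ℂ}
  (h : IsMinimalLegendrian F u (fun z => -Complex.I * (lam ^ (-3 : ℤ) * ψ z)))
include h

theorem contDiff_legendrianFrame (i j : Fin 3) :
    ContDiff ℝ ∞ (fun z => legendrianFrame F u lam z i j) := by
  have hE : ContDiff ℝ ∞ (fun z => (Real.exp (-u z / 2) : ℂ)) :=
    Complex.ofRealCLM.contDiff.comp (h.smooth_u.neg.div_const 2).exp
  fin_cases j
  · exact (contDiff_const.mul hE).mul (contDiff_pi.1 (contDiff_dz h.smooth) i)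
  · exact (contDiff_const.mul hE).mul (contDiff_pi.1 (contDiff_dzbar h.smooth) i)
  · exact contDiff_pi.1 h.smooth i

theorem conjTranspose_mul_legendrianFrame (hlam : ‖lam‖ = 1) (z : ℂ) :
    (legendrianFrame F u lam z)ᴴ * legendrianFrame F u lam z = 1 := by
  have hl : lam * star lam = 1 := by
    rw [Complex.star_def, Complex.mul_conj']; simp [hlam]
  have hl' : lam⁻¹ = star lam := inv_eq_of_mul_eq_one_right hl
  have hE : (Real.exp (-u z / 2) : ℂ) * Real.exp (-u z / 2) * Real.exp (u z) = 1 := by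
    rw [← Complex.ofReal_mul, ← Complex.ofReal_mul, ← Real.exp_add, ← Real.exp_add]
    ring_nf; simp
  have sI : star Complex.I = -Complex.I := Complex.conj_I
  have sE : star (Real.exp (-u z / 2) : ℂ) = Real.exp (-u z / 2) := Complex.conj_ofReal _
  have hI := Complex.I_mul_I
  have col : ∀ i j, ((legendrianFrame F u lam z)ᴴ * legendrianFrame F u lam z) i j =
      herm (fun k => legendrianFrame F u lam z k j) (fun k => legendrianFrame F u lam z k i) := by
    intro i j
    simp only [Matrix.mul_apply, Matrix.conjTranspose_apply, herm, dotProduct, Pi.star_apply,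
      mul_comm]
  have c0 : (fun k => legendrianFrame F u lam z k 0) =
    (-Complex.I * lam * Real.exp (-u z / 2)) • dz F z := rfl
  have c1 : (fun k => legendrianFrame F u lam z k 1) =
    (-Complex.I * lam⁻¹ * Real.exp (-u z / 2)) • dzbar F z := rfl
  have c2 : (fun k => legendrianFrame F u lam z k 2) = F z := rfl
  ext i j
  rw [col]
  fin_cases i <;> fin_cases j <;> simp only [Fin.zero_eta, Fin.mk_one, Fin.reduceFinMk, c0, c1, c2,
    herm_smul_left, herm_smul_right, h.metric_z, h.metric_zbar, h.conformal, h.unit,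
    h.horizontal_z, h.horizontal_zbar, herm_swap_eq_zero (h.conformal z),
    herm_swap_eq_zero (h.horizontal_z z), herm_swap_eq_zero (h.horizontal_zbar z), mul_zero,
    star_mul', star_neg, sI, sE, hl', star_star]
  · rw [Matrix.one_apply_eq]
    linear_combination (-Complex.I * Complex.I * lam * star lam) * hE -
      (lam * star lam) * hI + hl
  · simp
  · simp
  · simp
  · rw [Matrix.one_apply_eq]
    linear_combination (-Complex.I * Complex.I * lam * star lam) * hE -
      (lam * star lam) * hI + hl
  all_goals simp

/-- The structure equations rewritten in unit columns. The phases -iλ and -iλ⁻¹ of the first two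
columns absorb λ: the Hopf coefficient -iλ⁻³ψ turns into the matrix entry -iλ⁻¹ψ e^{-u}. -/
theorem dz_legendrianFrame (hlam : ‖lam‖ = 1) (z : ℂ) (i j : Fin 3) :
    dz (fun w => legendrianFrame F u lam w i j) z =
      (legendrianFrame F u lam z * frameU u ψ lam z) i j := by
  have hl0 : lam ≠ 0 := by rintro rfl; simp at hlam
  have hE2 : (Real.exp (-u z) : ℂ) = Real.exp (-u z / 2) * Real.exp (-u z / 2) := by
    rw [← Complex.ofReal_mul, ← Real.exp_add]; ring_nf
  have hE1 : Complex.exp (u z / 2) * Complex.exp (-(u z / 2)) = 1 := by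
    rw [← Complex.exp_add]; simp
  have hEu : (Real.exp (u z) : ℂ) = Real.exp (u z / 2) * Real.exp (u z / 2) := by
    rw [← Complex.ofReal_mul, ← Real.exp_add]; ring_nf
  have hc : ∀ c : ℂ, ContDiff ℝ ∞ (fun z => c * (Real.exp (-u z / 2) : ℂ)) := fun c =>
    contDiff_const.mul (Complex.ofRealCLM.contDiff.comp (h.smooth_u.neg.div_const 2).exp)
  have hcd := fun c => (hc c).differentiable (by simp) z
  have he : ∀ c : ℂ, dz (fun z => c * (Real.exp (-u z / 2) : ℂ)) z =
      -(c * Real.exp (-u z / 2)) * dz (fun w => (u w : ℂ)) z / 2 := by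
    intro c
    have h1 := dz_ofReal_comp (g := fun t => Real.exp (-t / 2)) (u := u) (z := z)
      ((Real.hasDerivAt_exp _).comp _ ((hasDerivAt_neg _).div_const 2)) (h.diff_u z)
    have h2 := dz_const_smul (G := fun z => (Real.exp (-u z / 2) : ℂ)) (z := z) c
      ((Complex.ofRealCLM.contDiff.comp (h.smooth_u.neg.div_const 2).exp).differentiable
        (by simp) z)
    simp only [smul_eq_mul] at h2
    rw [h2, h1]; push_cast; ring
  have hI := Complex.I_mul_I
  fin_cases j
  · have hv := dz_smul (hcd (-Complex.I * lam)) (h.diff_dz z)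
    have hv' := congrFun hv i
    rw [dz_apply ((hcd _).fun_smul (h.diff_dz z))] at hv'
    refine hv'.trans ?_
    rw [he, h.dz_dz_F]
    simp only [Matrix.mul_apply, Fin.sum_univ_three]
    simp [frameU, legendrianFrame, hE2, zpow_neg]
    field_simp
    ring
  · have hv := dz_smul (hcd (-Complex.I * lam⁻¹)) (h.diff_dzbar z)
    have hv' := congrFun hv i
    rw [dz_apply ((hcd _).fun_smul (h.diff_dzbar z))] at hv'
    refine hv'.trans ?_
    rw [he, ← dz_comm h.smooth, h.dzbar_dz_F, hEu]
    simp only [Matrix.mul_apply, Fin.sum_univ_three]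
    simp [frameU, legendrianFrame]
    field_simp
    linear_combination 2 * Complex.exp (u z / 2) * F z i * hE1
  · refine (dz_apply (h.diff z) i).symm.trans ?_
    simp only [Matrix.mul_apply, Fin.sum_univ_three]
    simp [frameU, legendrianFrame]
    field_simp
    linear_combination -dz F z i * hE1 +
      Complex.exp (u z / 2) * Complex.exp (-(u z / 2)) * dz F z i * hI

theorem dzbar_legendrianFrame (hlam : ‖lam‖ = 1) (z : ℂ) (i j : Fin 3) :
    dzbar (fun w => legendrianFrame F u lam w i j) z =
      (legendrianFrame F u lam z * frameV u ψ lam z) i j := by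
  have hl0 : lam ≠ 0 := by rintro rfl; simp at hlam
  have hE2 : (Real.exp (-u z) : ℂ) = Real.exp (-u z / 2) * Real.exp (-u z / 2) := by
    rw [← Complex.ofReal_mul, ← Real.exp_add]; ring_nf
  have hE1 : Complex.exp (u z / 2) * Complex.exp (-(u z / 2)) = 1 := by
    rw [← Complex.exp_add]; simp
  have hEu : (Real.exp (u z) : ℂ) = Real.exp (u z / 2) * Real.exp (u z / 2) := by
    rw [← Complex.ofReal_mul, ← Real.exp_add]; ring_nf
  have hc : ∀ c : ℂ, ContDiff ℝ ∞ (fun z => c * (Real.exp (-u z / 2) : ℂ)) := fun c =>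
    contDiff_const.mul (Complex.ofRealCLM.contDiff.comp (h.smooth_u.neg.div_const 2).exp)
  have hcd := fun c => (hc c).differentiable (by simp) z
  have he : ∀ c : ℂ, dzbar (fun z => c * (Real.exp (-u z / 2) : ℂ)) z =
      -(c * Real.exp (-u z / 2)) * dzbar (fun w => (u w : ℂ)) z / 2 := by
    intro c
    have h1 := dzbar_ofReal_comp (g := fun t => Real.exp (-t / 2)) (u := u) (z := z)
      ((Real.hasDerivAt_exp _).comp _ ((hasDerivAt_neg _).div_const 2)) (h.diff_u z)
    have h2 := dzbar_const_smul (G := fun z => (Real.exp (-u z / 2) : ℂ)) (z := z) c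
      ((Complex.ofRealCLM.contDiff.comp (h.smooth_u.neg.div_const 2).exp).differentiable
        (by simp) z)
    simp only [smul_eq_mul] at h2
    rw [h2, h1]; push_cast; ring
  have hI := Complex.I_mul_I
  have hss : star (lam ^ (-3 : ℤ)) = lam ^ 3 := by
    have hl : lam * star lam = 1 := by
      rw [Complex.star_def, Complex.mul_conj']; simp [hlam]
    rw [star_zpow₀, ← inv_eq_of_mul_eq_one_right hl]
    simp
  fin_cases j
  · have hv := dzbar_smul (hcd (-Complex.I * lam)) (h.diff_dz z)
    have hv' := congrFun hv i
    rw [dzbar_apply ((hcd _).fun_smul (h.diff_dz z))] at hv'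
    refine hv'.trans ?_
    rw [he, h.dzbar_dz_F, hEu]
    simp only [Matrix.mul_apply, Fin.sum_univ_three]
    simp [frameV, legendrianFrame]
    field_simp
    linear_combination 2 * Complex.exp (u z / 2) * F z i * hE1
  · have hv := dzbar_smul (hcd (-Complex.I * lam⁻¹)) (h.diff_dzbar z)
    have hv' := congrFun hv i
    rw [dzbar_apply ((hcd _).fun_smul (h.diff_dzbar z))] at hv'
    refine hv'.trans ?_
    rw [he, h.dzbar_dzbar_F, star_mul', star_mul', hss]
    simp only [Matrix.mul_apply, Fin.sum_univ_three]
    simp [frameV, legendrianFrame, hE2]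
    field_simp
    ring
  · refine (dzbar_apply (h.diff z) i).symm.trans ?_
    simp only [Matrix.mul_apply, Fin.sum_univ_three]
    simp [frameV, legendrianFrame]
    field_simp
    linear_combination -dzbar F z i * hE1 +
      Complex.exp (u z / 2) * Complex.exp (-(u z / 2)) * dzbar F z i * hI

theorem det_legendrianFrame (hlam : ‖lam‖ = 1) (z : ℂ) :
    (legendrianFrame F u lam z).det = (legendrianFrame F u lam 0).det := by
  have hd : ∀ z i j, DifferentiableAt ℝ (fun w => legendrianFrame F u lam w i j) z :=
    fun z i j => (h.contDiff_legendrianFrame i j).differentiable (by simp) z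
  refine eq_of_dz_dzbar_eq_zero (G := fun z => (legendrianFrame F u lam z).det) ?_ ?_ ?_ z 0
  · intro z
    simp only [Matrix.det_fin_three]
    have d := hd z
    fun_prop
  · intro z
    rw [dz_det (hd z) (h.dz_legendrianFrame hlam z), trace_frameU, zero_mul]
  · intro z
    rw [dzbar_det (hd z) (h.dzbar_legendrianFrame hlam z), trace_frameV, zero_mul]

/-- A constant left factor preserves the frame equations. The determinant becomes 1 because the
determinant of the unnormalized frame is constant. -/
theorem isExtendedFrame (hlam : ‖lam‖ = 1) : IsExtendedFrame u ψ lam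
    (fun z => (legendrianFrame F u lam 0)ᴴ * legendrianFrame F u lam z) := by
  have hU := h.conjTranspose_mul_legendrianFrame hlam
  have hsm := h.contDiff_legendrianFrame (lam := lam)
  have hd : ∀ z i j, DifferentiableAt ℝ (fun w => legendrianFrame F u lam w i j) z :=
    fun z i j => (hsm i j).differentiable (by simp) z
  have hmem : ∀ z, legendrianFrame F u lam z ∈ Matrix.unitaryGroup (Fin 3) ℂ := fun z =>
    Matrix.mem_unitaryGroup_iff'.2 (hU z)
  refine ⟨fun z => ?_, fun i j => ?_, fun z => ?_, fun z => ?_, hU 0⟩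
  · refine Matrix.mem_specialUnitaryGroup_iff.2 ⟨mul_mem (Unitary.star_mem (hmem 0)) (hmem z), ?_⟩
    rw [Matrix.det_mul, h.det_legendrianFrame hlam z, ← Matrix.det_mul, hU 0, Matrix.det_one]
  · simp only [Matrix.mul_apply, Fin.sum_univ_three]
    exact ((contDiff_const.mul (hsm _ _)).add (contDiff_const.mul (hsm _ _))).add
      (contDiff_const.mul (hsm _ _))
  · exact dz_const_mul_matrix _ (hd z) (h.dz_legendrianFrame hlam z)
  · exact dzbar_const_mul_matrix _ (hd z) (h.dzbar_legendrianFrame hlam z)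

theorem exists_canonicalLift (hlam : ‖lam‖ = 1) {f : ℂ → CP2} (hf : IsHorizontalLift f F) :
    ∃ G, IsCanonicalLift f u ψ lam G := by
  set Ψ := legendrianFrame F u lam with hΨ
  have hU : ∀ z, (Ψ z)ᴴ * Ψ z = 1 := h.conjTranspose_mul_legendrianFrame hlam
  have hU' : ∀ z, Ψ z * (Ψ z)ᴴ = 1 := fun z => mul_eq_one_comm.1 (hU z)
  -- The isometry carrying the normalized lift back to f is Ψ(0), which is only unitary. A cube root
  -- of 1/det moves it into SU(3), and the scalar does not affect its action on ℂP².
  obtain ⟨μ, hμ⟩ := IsAlgClosed.exists_pow_nat_eq ((Ψ 0).det⁻¹) (n := 3) (by norm_num)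
  have hdet : star (Ψ 0).det * (Ψ 0).det = 1 := by
    rw [← Matrix.det_conjTranspose, ← Matrix.det_mul, hU, Matrix.det_one]
  have hdet0 : (Ψ 0).det ≠ 0 := right_ne_zero_of_mul_eq_one hdet
  have hnd : ‖(Ψ 0).det‖ = 1 := by
    rw [Complex.star_def, Complex.conj_mul'] at hdet
    have : ‖(Ψ 0).det‖ ^ 2 = 1 := by exact_mod_cast hdet
    exact (pow_eq_one_iff_of_nonneg (norm_nonneg _) two_ne_zero).1 this
  have hnμ : ‖μ‖ = 1 := by
    have : ‖μ‖ ^ 3 = 1 := by rw [← norm_pow, hμ, norm_inv, hnd, inv_one]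
    exact (pow_eq_one_iff_of_nonneg (norm_nonneg _) three_ne_zero).1 this
  have hμ0 : μ ≠ 0 := by rintro rfl; simp at hnμ
  let A : Matrix.SpecialLinearGroup (Fin 3) ℂ := ⟨μ • Ψ 0, by
    rw [Matrix.det_smul, Fintype.card_fin, hμ, inv_mul_cancel₀ hdet0]⟩
  have hFr := h.isExtendedFrame hlam
  have hcol : ∀ z, (Ψ 0) *ᵥ (fun i => ((Ψ 0)ᴴ * Ψ z) i 2) = F z := by
    intro z
    have : (fun i => ((Ψ 0)ᴴ * Ψ z) i 2) = (Ψ 0)ᴴ *ᵥ F z := by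
      ext i; rfl
    rw [this, Matrix.mulVec_mulVec, hU', Matrix.one_mulVec]
  refine ⟨fun z i => ((Ψ 0)ᴴ * Ψ z) i 2, ⟨_, hFr, fun z i => rfl⟩, A, ?_, fun z => ?_⟩
  · refine Matrix.mem_unitaryGroup_iff.2 ?_
    show (μ • Ψ 0) * star (μ • Ψ 0) = 1
    rw [star_smul, Matrix.star_eq_conjTranspose, Matrix.smul_mul, Matrix.mul_smul, hU', smul_smul,
      Complex.star_def, Complex.mul_conj', hnμ]
    simp
  · obtain ⟨hF0, hF⟩ := hf.lift z
    have hne : (fun i => ((Ψ 0)ᴴ * Ψ z) i 2) ≠ 0 := by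
      intro h0
      have := hcol z
      rw [h0, Matrix.mulVec_zero] at this
      exact hF0 this.symm
    refine ⟨hne, ?_⟩
    rw [← hF, Projectivization.smul_mk, Projectivization.mk_eq_mk_iff]
    refine ⟨(Units.mk0 μ hμ0)⁻¹, ?_⟩
    have : A • (fun i => ((Ψ 0)ᴴ * Ψ z) i 2) = μ • F z := by
      show (μ • Ψ 0) *ᵥ _ = _
      rw [Matrix.smul_mulVec, hcol]
    rw [this, Units.smul_def, smul_smul]
    simp [hμ0]

end IsMinimalLegendrian

/-! ### Invariance of the metric under equivariant translations. -/

theorem herm_mulVec {B : Matrix (Fin 3) (Fin 3) ℂ} (hB : B ∈ Matrix.unitaryGroup (Fin 3) ℂ)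
    (X Y : Fin 3 → ℂ) : herm (B *ᵥ X) (B *ᵥ Y) = herm X Y := by
  unfold herm
  rw [Matrix.star_mulVec, dotProduct_comm, Matrix.dotProduct_mulVec, Matrix.vecMul_vecMul,
    ← Matrix.star_eq_conjTranspose, Matrix.mem_unitaryGroup_iff'.1 hB, Matrix.vecMul_one,
    dotProduct_comm]

theorem fderiv_mulVec (B : Matrix (Fin 3) (Fin 3) ℂ) {F : ℂ → Fin 3 → ℂ} {z : ℂ}
    (hF : DifferentiableAt ℝ F z) (v : ℂ) :
    fderiv ℝ (fun w => B *ᵥ F w) z v = B *ᵥ fderiv ℝ F z v := by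
  have h1 := ((((Matrix.mulVecLin B).restrictScalars ℝ).toContinuousLinearMap.hasFDerivAt
    (x := F z)).comp z hF.hasFDerivAt).fderiv
  erw [h1]
  rfl

theorem dz_mulVec (B : Matrix (Fin 3) (Fin 3) ℂ) {F : ℂ → Fin 3 → ℂ} {z : ℂ}
    (hF : DifferentiableAt ℝ F z) : dz (fun w => B *ᵥ F w) z = B *ᵥ dz F z := by
  simp only [dz, fderiv_mulVec B hF, Matrix.mulVec_smul, Matrix.mulVec_sub]

/-- Translated and rotated lifts cover the same map, so F(t + w) = c(w) B F(w) with |c| = 1. Both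
sides are horizontal, which forces c_z = 0, and then the z-derivatives differ by a unitary matrix
and a phase. -/
theorem metric_translate_eq {f : ℂ → CP2} {F : ℂ → Fin 3 → ℂ} (hF : IsHorizontalLift f F)
    {R : Matrix.SpecialLinearGroup (Fin 3) ℂ} (hR : IsSU3 R) {t : ℂ}
    (hf : ∀ z, f (t + z) = R • f z) (z : ℂ) :
    herm (dz F (t + z)) (dz F (t + z)) = herm (dz F z) (dz F z) := by
  set B : Matrix (Fin 3) (Fin 3) ℂ := R.1
  have hd := hF.smooth.differentiable (by simp)
  let G : ℂ → Fin 3 → ℂ := fun w => F (t + w)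
  let c : ℂ → ℂ := fun w => herm (G w) (B *ᵥ F w)
  have hBF : ContDiff ℝ ∞ (fun w => B *ᵥ F w) :=
    ((Matrix.mulVecLin B).restrictScalars ℝ).toContinuousLinearMap.contDiff.comp hF.smooth
  have hBFd := hBF.differentiable (by simp)
  have hc : Differentiable ℝ c :=
    (contDiff_herm (hF.smooth.comp (contDiff_const.add contDiff_id)) hBF).differentiable (by simp)
  have hun : ∀ w, herm (B *ᵥ F w) (B *ᵥ F w) = 1 := fun w => by rw [herm_mulVec hR, hF.unit]
  have key : ∀ w, G w = c w • (B *ᵥ F w) := by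
    intro w
    obtain ⟨h1, h1'⟩ := hF.lift (t + w)
    obtain ⟨h2, h2'⟩ := hF.lift w
    have h3 := hf w
    rw [← h1', ← h2', Projectivization.smul_mk, Projectivization.mk_eq_mk_iff] at h3
    obtain ⟨a, ha⟩ := h3
    have ha' : G w = (a : ℂ) • (B *ᵥ F w) := ha.symm
    show G w = herm (G w) (B *ᵥ F w) • (B *ᵥ F w)
    rw [ha', herm_smul_left, hun, mul_one]
  have hnc : ∀ w, c w * star (c w) = 1 := by
    intro w
    have := hF.unit (t + w)
    rw [show F (t + w) = _ from key w, herm_smul_left, herm_smul_right, hun] at this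
    linear_combination this
  have hdG : dz G z = dz c z • (B *ᵥ F z) + c z • (B *ᵥ dz F z) := by
    rw [show G = _ from funext key, dz_smul (hc z) (hBFd z), dz_mulVec B (hd z)]
  have hdz : dz G z = dz F (t + z) := dz_translate F t z
  have hzero : dz c z = 0 := by
    have h1 := hF.horizontal_z (t + z)
    rw [← hdz, hdG, show F (t + z) = _ from key z, herm_add_left, herm_smul_left, herm_smul_left,
      herm_smul_right, herm_smul_right, hun, herm_mulVec hR, hF.horizontal_z] at h1
    have h2 : c z ≠ 0 := left_ne_zero_of_mul_eq_one (hnc z)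
    simpa [h2] using h1
  rw [← hdz, hdG, hzero, zero_smul, zero_add, herm_smul_left, herm_smul_right, herm_mulVec hR]
  linear_combination herm (dz F z) (dz F z) * hnc z

/-! ### Jacobi elliptic functions for k² < 1. -/

section Elliptic

variable {k : ℝ} (hk : k ^ 2 < 1)
include hk

theorem one_sub_sq_sin_pos (θ : ℝ) : 0 < 1 - k ^ 2 * Real.sin θ ^ 2 := by
  nlinarith [Real.sin_sq_le_one θ, sq_nonneg k, sq_nonneg (Real.sin θ)]

theorem continuous_ellipticJ_integrand :
    Continuous (fun α : ℝ => 1 / Real.sqrt (1 - k ^ 2 * Real.sin α ^ 2)) :=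
  continuous_const.div (by fun_prop) fun α => (Real.sqrt_pos.2 (one_sub_sq_sin_pos hk α)).ne'

theorem hasDerivAt_ellipticJ (θ : ℝ) : HasDerivAt (fun θ => ellipticJ θ k)
    (1 / Real.sqrt (1 - k ^ 2 * Real.sin θ ^ 2)) θ :=
  (continuous_ellipticJ_integrand hk).integral_hasStrictDerivAt 0 θ |>.hasDerivAt

theorem strictMono_ellipticJ : StrictMono (fun θ => ellipticJ θ k) :=
  strictMono_of_hasDerivAt_pos (hasDerivAt_ellipticJ hk) fun θ => by
    have := Real.sqrt_pos.2 (one_sub_sq_sin_pos hk θ)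
    positivity

omit hk in
theorem ellipticJ_zero : ellipticJ 0 k = 0 := by simp [ellipticJ]

/-- The integrand is at least 1. Comparison with the identity then gives the limits at ±∞ that make
the elliptic integral surjective. -/
theorem monotone_ellipticJ_sub : Monotone (fun θ => ellipticJ θ k - θ) := by
  have hd : ∀ θ, HasDerivAt (fun θ => ellipticJ θ k - θ)
      (1 / Real.sqrt (1 - k ^ 2 * Real.sin θ ^ 2) - 1) θ := fun θ =>
    (hasDerivAt_ellipticJ hk θ).sub (hasDerivAt_id θ)
  refine monotone_of_deriv_nonneg (fun θ => (hd θ).differentiableAt) fun θ => ?_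
  rw [(hd θ).deriv, sub_nonneg, le_div_iff₀ (Real.sqrt_pos.2 (one_sub_sq_sin_pos hk θ)), one_mul,
    Real.sqrt_le_one]
  nlinarith [mul_nonneg (sq_nonneg k) (sq_nonneg (Real.sin θ))]

theorem continuous_ellipticJ : Continuous (fun θ => ellipticJ θ k) :=
  continuous_iff_continuousAt.2 fun θ => (hasDerivAt_ellipticJ hk θ).continuousAt

theorem surjective_ellipticJ : Function.Surjective (fun θ => ellipticJ θ k) := by
  have hm := monotone_ellipticJ_sub hk
  refine (continuous_ellipticJ hk).surjective ?_ ?_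
  · refine Filter.tendsto_atTop_mono' _ ?_ Filter.tendsto_id
    filter_upwards [Filter.eventually_ge_atTop 0] with θ hθ
    have := hm hθ
    simp only [ellipticJ_zero] at this
    simp only [id]; linarith
  · refine Filter.tendsto_atBot_mono' _ ?_ Filter.tendsto_id
    filter_upwards [Filter.eventually_le_atBot 0] with θ hθ
    have := hm hθ
    simp only [ellipticJ_zero] at this
    simp only [id]; linarith

theorem jacobiAm_ellipticJ (θ : ℝ) : jacobiAm (ellipticJ θ k) k = θ :=
  Function.leftInverse_invFun (strictMono_ellipticJ hk).injective θ

theorem ellipticJ_jacobiAm (x : ℝ) : ellipticJ (jacobiAm x k) k = x :=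
  Function.rightInverse_invFun (surjective_ellipticJ hk) x

theorem continuous_jacobiAm : Continuous (fun x => jacobiAm x k) := by
  let e := (strictMono_ellipticJ hk).orderIsoOfSurjective _ (surjective_ellipticJ hk)
  have : (fun x => jacobiAm x k) = e.symm := by
    funext x
    apply e.injective
    rw [e.apply_symm_apply]
    exact ellipticJ_jacobiAm hk x
  rw [this]
  exact e.symm.continuous

theorem hasDerivAt_jacobiAm (x : ℝ) : HasDerivAt (fun x => jacobiAm x k) (jacobiDn x k) x := by
  have h := HasDerivAt.of_local_left_inverse (continuous_jacobiAm hk).continuousAt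
    (hasDerivAt_ellipticJ hk (jacobiAm x k))
    (by
      have := Real.sqrt_pos.2 (one_sub_sq_sin_pos hk (jacobiAm x k))
      positivity)
    (Filter.Eventually.of_forall (ellipticJ_jacobiAm hk))
  simpa [jacobiDn] using h

theorem jacobiDn_pos (x : ℝ) : 0 < jacobiDn x k := Real.sqrt_pos.2 (one_sub_sq_sin_pos hk _)

theorem jacobiDn_sq (x : ℝ) : jacobiDn x k ^ 2 = 1 - k ^ 2 * jacobiSn x k ^ 2 :=
  Real.sq_sqrt (one_sub_sq_sin_pos hk _).le

omit hk in
theorem jacobiCn_sq (x : ℝ) : jacobiCn x k ^ 2 = 1 - jacobiSn x k ^ 2 :=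
  Real.cos_sq' _

theorem hasDerivAt_jacobiSn (x : ℝ) :
    HasDerivAt (fun x => jacobiSn x k) (jacobiCn x k * jacobiDn x k) x :=
  (hasDerivAt_jacobiAm hk x).sin

theorem hasDerivAt_jacobiCn (x : ℝ) :
    HasDerivAt (fun x => jacobiCn x k) (-jacobiSn x k * jacobiDn x k) x :=
  (hasDerivAt_jacobiAm hk x).cos

theorem hasDerivAt_jacobiDn (x : ℝ) :
    HasDerivAt (fun x => jacobiDn x k) (-k ^ 2 * jacobiSn x k * jacobiCn x k) x := by
  have h := ((((hasDerivAt_jacobiSn hk x).pow 2).const_mul (k ^ 2)).const_sub 1).sqrt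
    (one_sub_sq_sin_pos hk _).ne'
  refine h.congr_deriv ?_
  have hd := (jacobiDn_pos hk x).ne'
  rw [show Real.sqrt (1 - k ^ 2 * ((fun x => jacobiSn x k) ^ 2) x) = jacobiDn x k from rfl]
  field_simp
  simp
  ring

omit hk in
theorem jacobiSn_zero (hk : k ^ 2 < 1) : jacobiSn 0 k = 0 := by
  have := jacobiAm_ellipticJ hk 0
  rw [ellipticJ_zero] at this
  rw [jacobiSn, this, Real.sin_zero]

theorem jacobiCn_zero : jacobiCn 0 k = 1 := by
  have := jacobiAm_ellipticJ hk 0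
  rw [ellipticJ_zero] at this
  rw [jacobiCn, this, Real.cos_zero]

theorem jacobiDn_zero : jacobiDn 0 k = 1 := by
  have := jacobiAm_ellipticJ hk 0
  rw [ellipticJ_zero] at this
  rw [jacobiDn, this, Real.sin_zero]; simp

theorem ellipticK_pos : 0 < ellipticK k := by
  have := strictMono_ellipticJ hk (show (0 : ℝ) < Real.pi / 2 by positivity)
  simp only [ellipticJ_zero] at this
  exact this

/-- The integrand has period π and is symmetric about π/2. Hence J(θ + π) - J(θ) and J(π - θ) + J(θ)
are constant; the first equals J(π), and the second gives J(π) = 2K. -/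
theorem ellipticJ_add_pi (θ : ℝ) : ellipticJ (θ + Real.pi) k = ellipticJ θ k + 2 * ellipticK k := by
  have hd : ∀ θ, HasDerivAt (fun θ => ellipticJ (θ + Real.pi) k - ellipticJ θ k) 0 θ := by
    intro θ
    have h1 := (hasDerivAt_ellipticJ hk (θ + Real.pi)).comp_add_const θ Real.pi
    refine (h1.sub (hasDerivAt_ellipticJ hk θ)).congr_deriv ?_
    simp
  have hr : ∀ θ, HasDerivAt (fun θ => ellipticJ (Real.pi - θ) k + ellipticJ θ k) 0 θ := by
    intro θ
    have h1 := (hasDerivAt_ellipticJ hk (Real.pi - θ)).comp_const_sub Real.pi θ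
    refine (h1.add (hasDerivAt_ellipticJ hk θ)).congr_deriv ?_
    simp
  have e1 := is_const_of_deriv_eq_zero (fun θ => (hd θ).differentiableAt)
    (fun θ => (hd θ).deriv) θ 0
  have e2 := is_const_of_deriv_eq_zero (fun θ => (hr θ).differentiableAt)
    (fun θ => (hr θ).deriv) 0 (Real.pi / 2)
  simp only [zero_add, sub_zero, ellipticJ_zero, add_zero] at e1 e2
  rw [show Real.pi - Real.pi / 2 = Real.pi / 2 by ring] at e2
  unfold ellipticK
  linarith

theorem jacobiAm_add_period (x : ℝ) :
    jacobiAm (x + 4 * ellipticK k) k = jacobiAm x k + 2 * Real.pi := by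
  have h := ellipticJ_add_pi hk
  have : ellipticJ (jacobiAm x k + 2 * Real.pi) k = x + 4 * ellipticK k := by
    rw [show jacobiAm x k + 2 * Real.pi = jacobiAm x k + Real.pi + Real.pi by ring, h, h,
      ellipticJ_jacobiAm hk]
    ring
  rw [← this, jacobiAm_ellipticJ hk]

theorem jacobiSn_add_period (x : ℝ) : jacobiSn (x + 4 * ellipticK k) k = jacobiSn x k := by
  rw [jacobiSn, jacobiAm_add_period hk, Real.sin_add_two_pi, jacobiSn]

theorem jacobiCn_add_period (x : ℝ) : jacobiCn (x + 4 * ellipticK k) k = jacobiCn x k := by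
  rw [jacobiCn, jacobiAm_add_period hk, Real.cos_add_two_pi, jacobiCn]

theorem jacobiDn_add_period (x : ℝ) : jacobiDn (x + 4 * ellipticK k) k = jacobiDn x k := by
  rw [jacobiDn, jacobiAm_add_period hk, Real.sin_add_two_pi, jacobiDn]

/-- Provides a height at which all three components of the lift are nonzero; amplitude π/4 serves.
-/
theorem exists_jacobi_ne_zero : ∃ x, jacobiSn x k ≠ 0 ∧ jacobiCn x k ≠ 0 ∧ jacobiDn x k ≠ 0 := by
  refine ⟨ellipticJ (Real.pi / 4) k, ?_, ?_, (jacobiDn_pos hk _).ne'⟩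
  · rw [jacobiSn, jacobiAm_ellipticJ hk, Real.sin_pi_div_four]; positivity
  · rw [jacobiCn, jacobiAm_ellipticJ hk, Real.cos_pi_div_four]; positivity

end Elliptic

/-- Uniqueness for the linear second order equation `e'' = q e` with bounded coefficient. -/
theorem eq_zero_of_second_order {E : Type*} [NormedAddCommGroup E] [NormedSpace ℝ E]
    {q : ℝ → ℝ} {C : ℝ} (hq : ∀ t, |q t| ≤ C) {e e' : ℝ → E}
    (h1 : ∀ t, HasDerivAt e (e' t) t) (h2 : ∀ t, HasDerivAt e' (q t • e t) t)
    (h01 : e 0 = 0) (h02 : e' 0 = 0) (t : ℝ) : e t = 0 := by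
  -- First-order system for (e, e'). In the sup norm of the product it is Lipschitz with constant
  -- max(1, C), uniformly in t.
  let v : ℝ → E × E → E × E := fun t p => (p.2, q t • p.1)
  have hv : ∀ t, LipschitzOnWith (Real.toNNReal (max 1 C)) (v t) Set.univ := by
    intro t
    refine LipschitzOnWith.of_dist_le_mul fun p _ p' _ => ?_
    rw [Real.coe_toNNReal _ (le_max_of_le_left zero_le_one), Prod.dist_eq, Prod.dist_eq]
    refine max_le ?_ ?_
    · calc dist p.2 p'.2 ≤ 1 * max (dist p.1 p'.1) (dist p.2 p'.2) := by
            rw [one_mul]; exact le_max_right _ _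
        _ ≤ _ := by gcongr; exact le_max_left _ _
    · calc dist (q t • p.1) (q t • p'.1) = |q t| * dist p.1 p'.1 := by
            rw [dist_smul₀, Real.norm_eq_abs]
        _ ≤ _ := by
            gcongr
            · exact (hq t).trans (le_max_right _ _)
            · exact le_max_left _ _
  have key : (fun t => (e t, e' t)) = fun _ => ((0 : E), (0 : E)) := by
    refine ODE_solution_unique_univ (v := v) (s := fun _ => Set.univ) (t₀ := 0) hv
      (fun t => ⟨(h1 t).prodMk (h2 t), trivial⟩) (fun t => ⟨?_, trivial⟩) ?_
    · exact (hasDerivAt_const t ((0 : E), (0 : E))).congr_deriv (by simp [v]; rfl)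
    · simp [h01, h02]
  exact congrArg Prod.fst (congrFun key t)

/-- `a₁ > a₂ > 0 > -a₃` are the roots of `w³ - (a₁ + a₂ - a₃) w² + p² / 2`, and `p > 0`. -/
structure IsRootTriple (a₁ a₂ a₃ p : ℝ) : Prop where
  pos₂ : 0 < a₂
  pos₃ : 0 < a₃
  lt : a₂ < a₁
  pos_p : 0 < p
  sq_p : p ^ 2 = 2 * a₁ ^ 2 * (a₂ - a₃)
  mul_eq : a₂ * a₃ = a₁ * (a₂ - a₃)

/-- With p² = 2 a₁² s, the numbers a₂ and -a₃ are the roots of w² - s w - s a₁. The bound p² < a₁³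
means 2s < a₁, which is exactly what places a₂ below a₁. -/
theorem isRootTriple_of_formula {a₁ a₂ a₃ β p : ℝ} (h₁ : 0 < a₁) (hp : 0 < p)
    (hlt : p ^ 2 < a₁ ^ 3) (hβ : β = 2 * a₁ + p ^ 2 / a₁ ^ 2)
    (ha₂ : a₂ = (β / 2 - a₁ + Real.sqrt ((β / 2 - a₁) ^ 2 + 4 * a₁ * (β / 2 - a₁))) / 2)
    (ha₃ : a₃ = (-(β / 2 - a₁) + Real.sqrt ((β / 2 - a₁) ^ 2 + 4 * a₁ * (β / 2 - a₁))) / 2) :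
    IsRootTriple a₁ a₂ a₃ p := by
  set s := β / 2 - a₁ with hs
  have hs' : p ^ 2 = 2 * a₁ ^ 2 * s := by rw [hs, hβ]; field_simp; ring
  have hs0 : 0 < s := by
    by_contra hcon
    have : 0 < p ^ 2 := by positivity
    nlinarith [sq_nonneg a₁]
  have hs1 : 2 * s < a₁ := by
    have h : a₁ ^ 2 * (2 * s) < a₁ ^ 2 * a₁ := by nlinarith
    exact lt_of_mul_lt_mul_left h (sq_nonneg _)
  set q := Real.sqrt (s ^ 2 + 4 * a₁ * s) with hq
  have hq2 : q ^ 2 = s ^ 2 + 4 * a₁ * s := Real.sq_sqrt (by positivity)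
  have hq0 : 0 ≤ q := Real.sqrt_nonneg _
  have hqs : s < q := lt_of_pow_lt_pow_left₀ 2 hq0 (by rw [hq2]; nlinarith [mul_pos h₁ hs0])
  have hqa : q < 2 * a₁ - s := lt_of_pow_lt_pow_left₀ 2 (by linarith) (by rw [hq2]; nlinarith)
  refine ⟨by linarith, by linarith, by linarith, hp, ?_, ?_⟩
  · rw [hs', ha₂, ha₃]; ring
  · rw [ha₂, ha₃]; linear_combination hq2 / 4

/-! ### The Gauss equation as an ODE and its solution by sn. -/

section ODE

variable {v v' : ℝ → ℝ} {p : ℝ} (h1 : ∀ y, HasDerivAt v (v' y) y)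
  (h2 : ∀ y, HasDerivAt v' (4 * (p ^ 2 * Real.exp (-v y) ^ 2 - Real.exp (v y))) y)
include h1 h2

/-- The energy v'²/8 + e^v + p² e^{-2v}/2 is conserved. Evaluating it at the critical point 0 lets
the factor e^v - e^{v(0)} split off the cubic. -/
theorem first_integral (h0 : v' 0 = 0) (y : ℝ) :
    (v' y) ^ 2 * Real.exp (v y) ^ 2 = -8 * (Real.exp (v y) - Real.exp (v 0)) *
      (Real.exp (v y) ^ 2 - p ^ 2 / (2 * Real.exp (v 0) ^ 2) * (Real.exp (v y) + Real.exp (v 0))) := by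
  have hd : ∀ y, HasDerivAt (fun y => v' y ^ 2 / 8 + Real.exp (v y) +
      p ^ 2 * Real.exp (-v y) ^ 2 / 2) 0 y := by
    intro y
    have e := ((((h2 y).pow 2).div_const 8).add (h1 y).exp).add
      (((((h1 y).neg).exp.pow 2).const_mul (p ^ 2)).div_const 2)
    refine e.congr_deriv ?_
    simp
    ring
  have hc := is_const_of_deriv_eq_zero (fun y => (hd y).differentiableAt)
    (fun y => (hd y).deriv) y 0
  simp only [h0, Real.exp_neg] at hc
  have p1 := Real.exp_pos (v y)
  have p0 := Real.exp_pos (v 0)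
  field_simp at hc ⊢
  linear_combination 1 * hc

/-- If p² ≥ a³ with a = e^{v(0)}, then at a point with w < a both factors in the first integral are
negative, and the square v'² w² would be negative. -/
theorem sq_lt_of_nonconstant (hmax : ∀ y, v y ≤ v 0) (hne : ∃ y, v y ≠ v 0) :
    p ^ 2 < Real.exp (v 0) ^ 3 := by
  have h0 : v' 0 = 0 := by
    have : IsLocalMax v 0 := Filter.Eventually.of_forall hmax
    exact this.hasDerivAt_eq_zero (h1 0)
  obtain ⟨y, hy⟩ := hne
  by_contra! hcon
  have hI := first_integral h1 h2 h0 y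
  have hlt : Real.exp (v y) < Real.exp (v 0) := Real.exp_lt_exp.2 (lt_of_le_of_ne (hmax y) hy)
  have pw := Real.exp_pos (v y)
  set w := Real.exp (v y)
  set a := Real.exp (v 0)
  have pa : 0 < a := pw.trans hlt
  have hs : a / 2 ≤ p ^ 2 / (2 * a ^ 2) := by
    rw [div_le_div_iff₀ (by positivity) (by positivity)]; nlinarith
  -- At the threshold p² = a³ the quadratic is (w - a)(w + a/2), which is already negative.
  have hneg : w ^ 2 - p ^ 2 / (2 * a ^ 2) * (w + a) < 0 := by
    have : a / 2 * (w + a) ≤ p ^ 2 / (2 * a ^ 2) * (w + a) := by gcongr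
    nlinarith
  have : 0 < (w - a) * (w ^ 2 - p ^ 2 / (2 * a ^ 2) * (w + a)) :=
    mul_pos_of_neg_of_neg (by linarith) hneg
  nlinarith [mul_nonneg (sq_nonneg (v' y)) (sq_nonneg w)]

/-- The first-order equation degenerates at the maximum and does not determine w there. Its
derivative w'' = 8 (a₁ + a₂ - a₃) w - 12 w² does; the sn² expression solves the same equation with
the same value and slope at 0. -/
theorem exp_eq_jacobi {a₂ a₃ k r : ℝ} (hmax : ∀ y, v y ≤ v 0)
    (H : IsRootTriple (Real.exp (v 0)) a₂ a₃ p)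
    (hk : k ^ 2 * (Real.exp (v 0) + a₃) = Real.exp (v 0) - a₂)
    (hr : r ^ 2 = 2 * (Real.exp (v 0) + a₃)) (y : ℝ) :
    Real.exp (v y) = Real.exp (v 0) - (Real.exp (v 0) - a₂) * jacobiSn (r * y) k ^ 2 := by
  have h0 : v' 0 = 0 := by
    have : IsLocalMax v 0 := Filter.Eventually.of_forall hmax
    exact this.hasDerivAt_eq_zero (h1 0)
  have hI := first_integral h1 h2 h0
  have hle : ∀ y, Real.exp (v y) ≤ Real.exp (v 0) := fun y => Real.exp_le_exp.2 (hmax y)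
  have hpa := Real.exp_pos (v 0)
  generalize ha : Real.exp (v 0) = a at *
  obtain ⟨hp2, hp3, hlt, hp, hsq, hmul⟩ := H
  have hk1 : k ^ 2 < 1 := by nlinarith
  have hs : p ^ 2 / (2 * a ^ 2) = a₂ - a₃ := by rw [hsq]; field_simp
  rw [hs] at hI
  let g : ℝ → ℝ := fun y => a - (a - a₂) * jacobiSn (r * y) k ^ 2
  let g' : ℝ → ℝ := fun y =>
    -2 * (a - a₂) * r * (jacobiSn (r * y) k * (jacobiCn (r * y) k * jacobiDn (r * y) k))
  have hsn : ∀ y, HasDerivAt (fun y => jacobiSn (r * y) k)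
      (jacobiCn (r * y) k * jacobiDn (r * y) k * r) y := fun y =>
    (hasDerivAt_jacobiSn hk1 (r * y)).comp y (by simpa using (hasDerivAt_id y).const_mul r)
  have hcn : ∀ y, HasDerivAt (fun y => jacobiCn (r * y) k)
      (-jacobiSn (r * y) k * jacobiDn (r * y) k * r) y := fun y =>
    (hasDerivAt_jacobiCn hk1 (r * y)).comp y (by simpa using (hasDerivAt_id y).const_mul r)
  have hdn : ∀ y, HasDerivAt (fun y => jacobiDn (r * y) k)
      (-k ^ 2 * jacobiSn (r * y) k * jacobiCn (r * y) k * r) y := fun y =>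
    (hasDerivAt_jacobiDn hk1 (r * y)).comp y (by simpa using (hasDerivAt_id y).const_mul r)
  have hg : ∀ y, HasDerivAt g (g' y) y := fun y => by
    refine ((((hsn y).pow 2).const_mul (a - a₂)).const_sub a).congr_deriv ?_
    simp [g']; ring
  have hg' : ∀ y, HasDerivAt g' (8 * (a + a₂ - a₃) * g y - 12 * g y ^ 2) y := fun y => by
    refine (((hsn y).mul ((hcn y).mul (hdn y))).const_mul (-2 * (a - a₂) * r)).congr_deriv ?_
    have e1 := jacobiCn_sq (k := k) (r * y)
    have e2 := jacobiDn_sq hk1 (r * y)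
    simp only [g, Pi.mul_apply]
    generalize jacobiSn (r * y) k = S at *
    generalize jacobiCn (r * y) k = c at *
    generalize jacobiDn (r * y) k = d at *
    have step : -2 * (a - a₂) * r * (c * d * r * (c * d) +
        S * (-S * d * r * d + c * (-k ^ 2 * S * c * r))) =
        -2 * (a - a₂) * r ^ 2 * (c ^ 2 * d ^ 2 - S ^ 2 * d ^ 2 - k ^ 2 * S ^ 2 * c ^ 2) := by ring
    rw [step, e1, e2, hr]
    linear_combination (-4 * (a - a₂) * (-2 * S ^ 2 + 3 * S ^ 4)) * hk + 4 * hmul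
  let w' : ℝ → ℝ := fun y => v' y * Real.exp (v y)
  have hw : ∀ y, HasDerivAt (fun y => Real.exp (v y)) (w' y) y := fun y =>
    (h1 y).exp.congr_deriv (mul_comm _ _)
  have hw' : ∀ y, HasDerivAt w'
      (8 * (a + a₂ - a₃) * Real.exp (v y) - 12 * Real.exp (v y) ^ 2) y := fun y => by
    refine ((h2 y).mul (hw y)).congr_deriv ?_
    have pw := Real.exp_pos (v y)
    have := hI y
    simp only [w', Real.exp_neg]
    field_simp
    linear_combination this + 4 * hsq
  -- Since w² - g² = (w + g)(w - g), the difference w - g solves a linear equation. Its coefficient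
  -- is bounded because w and g both lie in [0, a].
  have key := eq_zero_of_second_order
    (q := fun y => 8 * (a + a₂ - a₃) - 12 * (Real.exp (v y) + g y))
    (C := 8 * (a + a₂ + a₃) + 24 * a)
    (e := fun y => Real.exp (v y) - g y) (e' := fun y => w' y - g' y) ?_
    (fun y => (hw y).sub (hg y)) (fun y => ((hw' y).sub (hg' y)).congr_deriv ?_) ?_ ?_ y
  · exact sub_eq_zero.1 key
  · intro t
    have hw1 := hle t
    have hw2 := Real.exp_pos (v t)
    have hS : jacobiSn (r * t) k ^ 2 ≤ 1 := Real.sin_sq_le_one _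
    have hS0 := sq_nonneg (jacobiSn (r * t) k)
    have hg1 : g t ≤ a := by simp only [g]; nlinarith
    have hg2 : 0 ≤ g t := by simp only [g]; nlinarith
    rw [abs_le]
    constructor <;> nlinarith
  · simp only [smul_eq_mul]; ring
  · simp [g, jacobiSn_zero hk1, ha]
  · simp [w', g', h0, jacobiSn_zero hk1]

end ODE

/-! ### Uniqueness of frames and left action of translations. -/

theorem mul_star_self_of_norm_eq_one {lam : ℂ} (hlam : ‖lam‖ = 1) : lam * star lam = 1 := by
  rw [Complex.star_def, Complex.mul_conj']; simp [hlam]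

theorem star_eq_inv_of_norm_eq_one {lam : ℂ} (hlam : ‖lam‖ = 1) : star lam = lam⁻¹ :=
  (inv_eq_of_mul_eq_one_right (mul_star_self_of_norm_eq_one hlam)).symm

/-- The reality condition of the connection for |λ| = 1; it makes norms of solutions constant. -/
theorem frameV_eq_neg_conjTranspose {u : ℂ → ℝ} {z : ℂ} (hu : DifferentiableAt ℝ u z) (ψ : ℂ → ℂ)
    {lam : ℂ} (hlam : ‖lam‖ = 1) : (frameV u ψ lam z)ᴴ = -frameU u ψ lam z := by
  have h1 := star_dz_ofReal hu
  have h2 : star (dzbar (fun w => (u w : ℂ)) z) = dz (fun w => (u w : ℂ)) z := by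
    rw [← h1, star_star]
  have h3 := star_eq_inv_of_norm_eq_one hlam
  simp only [Complex.star_def] at h1 h2 h3
  ext i j
  fin_cases i <;> fin_cases j <;>
    simp [frameU, frameV, h2, h3, -Complex.ofReal_exp] <;> ring

theorem herm_vecMul_right (X Y : Fin 3 → ℂ) (M : Matrix (Fin 3) (Fin 3) ℂ) :
    herm X (Y ᵥ* M) = herm (X ᵥ* Mᴴ) Y := by
  unfold herm
  rw [Matrix.star_vecMul, Matrix.dotProduct_mulVec]

/-- Solutions of the frame equations are determined by their value at the origin. -/
theorem frame_unique {u : ℂ → ℝ} (hu : Differentiable ℝ u) {ψ : ℂ → ℂ} {lam : ℂ}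
    (hlam : ‖lam‖ = 1) {Φ Ψ : ℂ → Matrix (Fin 3) (Fin 3) ℂ}
    (hΦ : ∀ i j, Differentiable ℝ (fun w => Φ w i j))
    (hΨ : ∀ i j, Differentiable ℝ (fun w => Ψ w i j))
    (hΦz : ∀ z i j, dz (fun w => Φ w i j) z = (Φ z * frameU u ψ lam z) i j)
    (hΨz : ∀ z i j, dz (fun w => Ψ w i j) z = (Ψ z * frameU u ψ lam z) i j)
    (hΦb : ∀ z i j, dzbar (fun w => Φ w i j) z = (Φ z * frameV u ψ lam z) i j)
    (hΨb : ∀ z i j, dzbar (fun w => Ψ w i j) z = (Ψ z * frameV u ψ lam z) i j)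
    (h0 : Φ 0 = Ψ 0) (z : ℂ) : Φ z = Ψ z := by
  ext i j
  -- A row of Φ - Ψ solves ρ_z = ρU, ρ_z̄ = ρV. Since V* = -U, |ρ|² has zero derivatives; it
  -- vanishes at 0, hence everywhere.
  let ρ : ℂ → Fin 3 → ℂ := fun w j => Φ w i j - Ψ w i j
  have hρ : Differentiable ℝ ρ := differentiable_pi.2 fun j => (hΦ i j).fun_sub (hΨ i j)
  have hz : ∀ z, dz ρ z = ρ z ᵥ* frameU u ψ lam z := by
    intro z; ext j
    rw [dz_apply (hρ z), dz_sub (hΦ i j z) (hΨ i j z), hΦz, hΨz, ← Matrix.sub_apply,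
      ← Matrix.sub_mul]
    rfl
  have hb : ∀ z, dzbar ρ z = ρ z ᵥ* frameV u ψ lam z := by
    intro z; ext j
    rw [dzbar_apply (hρ z), dzbar_sub (hΦ i j z) (hΨ i j z), hΦb, hΨb, ← Matrix.sub_apply,
      ← Matrix.sub_mul]
    rfl
  have hadj : ∀ z, frameV u ψ lam z = -(frameU u ψ lam z)ᴴ := fun z => by
    rw [← neg_neg (frameV u ψ lam z), ← Matrix.conjTranspose_conjTranspose (frameV u ψ lam z),
      frameV_eq_neg_conjTranspose (hu z) ψ hlam, Matrix.conjTranspose_neg, neg_neg]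
  have hdiff : Differentiable ℝ (fun w => herm (ρ w) (ρ w)) := by
    intro w
    simp only [herm_eq]
    have a := fun j => differentiableAt_pi.1 (hρ w) j
    have b := fun j => differentiableAt_star (a j)
    exact (((a 0).fun_mul (b 0)).fun_add ((a 1).fun_mul (b 1))).fun_add ((a 2).fun_mul (b 2))
  have hn : herm (ρ z) (ρ z) = 0 := by
    rw [eq_of_dz_dzbar_eq_zero hdiff (fun w => ?_) (fun w => ?_) z 0]
    · have : ρ 0 = 0 := by ext j; simp [ρ, h0]
      rw [this, herm_zero_left]
    · rw [dz_herm (hρ w) (hρ w), hz, hb, herm_vecMul_right,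
        frameV_eq_neg_conjTranspose (hu w) ψ hlam, Matrix.vecMul_neg, herm_neg_left,
        add_neg_cancel]
    · rw [dzbar_herm (hρ w) (hρ w), hz, hb, herm_vecMul_right, hadj, Matrix.vecMul_neg,
        herm_neg_left, neg_add_cancel]
  exact sub_eq_zero.1 (congrFun (herm_self_eq_zero hn) j)

namespace IsExtendedFrame

variable {u : ℂ → ℝ} {ψ : ℂ → ℂ} {lam : ℂ} {Φ : ℂ → Matrix (Fin 3) (Fin 3) ℂ}
  (h : IsExtendedFrame u ψ lam Φ)
include h

theorem diff (i j : Fin 3) : Differentiable ℝ (fun w => Φ w i j) :=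
  (h.smooth i j).differentiable (by simp)

theorem smooth_col (j : Fin 3) : ContDiff ℝ ∞ (fun w i => Φ w i j) :=
  contDiff_pi.2 fun i => h.smooth i j

/-- The coefficients are invariant under real translations, so both sides solve the same system and
they agree at z = 0. -/
theorem translate (hlam : ‖lam‖ = 1) (hu : Differentiable ℝ u)
    (hut : ∀ (t : ℝ) z, u (t + z) = u z) (hψ : ∀ z, ψ z = ψ 0) (t : ℝ) (z : ℂ) :
    Φ (t + z) = Φ t * Φ z := by
  have hu1 : ∀ z, dz (fun w => (u w : ℂ)) (t + z) = dz (fun w => (u w : ℂ)) z := fun z => by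
    rw [← dz_translate]; simp only [hut]
  have hu2 : ∀ z, dzbar (fun w => (u w : ℂ)) (t + z) = dzbar (fun w => (u w : ℂ)) z := fun z => by
    rw [← dzbar_translate]; simp only [hut]
  have hU : ∀ z, frameU u ψ lam (t + z) = frameU u ψ lam z := fun z => by
    simp only [frameU, hut, hu1, hψ (t + z), hψ z]
  have hV : ∀ z, frameV u ψ lam (t + z) = frameV u ψ lam z := fun z => by
    simp only [frameV, hut, hu2, hψ (t + z), hψ z]
  refine frame_unique hu hlam (Φ := fun z => Φ (t + z)) (Ψ := fun z => Φ t * Φ z)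
    (fun i j => (h.diff i j).comp (differentiable_id.const_add (t : ℂ))) (fun i j => ?_)
    (fun z i j => ?_) (fun z => dz_const_mul_matrix _ (fun i j => h.diff i j z) (h.eq_z z))
    (fun z i j => ?_) (fun z => dzbar_const_mul_matrix _ (fun i j => h.diff i j z) (h.eq_zbar z))
    ?_ z
  · simp only [Matrix.mul_apply, Fin.sum_univ_three]
    have := h.diff
    fun_prop
  · rw [dz_translate (fun w => Φ w i j), h.eq_z, hU]
  · rw [dzbar_translate (fun w => Φ w i j), h.eq_zbar, hV]
  · simp [h.init]

theorem fderiv_one (z : ℂ) (i j : Fin 3) : fderiv ℝ (fun w => Φ w i j) z 1 =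
    (Φ z * (frameU u ψ lam z + frameV u ψ lam z)) i j := by
  rw [fderiv_eq_dz_add_dzbar, h.eq_z, h.eq_zbar, Matrix.mul_add, Matrix.add_apply]

theorem hasDerivAt_real (t : ℝ) (i j : Fin 3) : HasDerivAt (fun s : ℝ => Φ s i j)
    ((Φ t * (frameU u ψ lam t + frameV u ψ lam t)) i j) t := by
  rw [← h.fderiv_one]
  exact (h.diff i j t).hasFDerivAt.comp_hasDerivAt t
    (Complex.ofRealCLM.hasDerivAt (x := t))

/-- The third column of the frame satisfies `F_{z z̄} = -e^u F`. -/
theorem dzbar_dz_col (hlam : ‖lam‖ = 1) (hu : ContDiff ℝ ∞ u) (z : ℂ) :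
    dzbar (dz (fun w i => Φ w i 2)) z = (-(Real.exp (u z)) : ℂ) • (fun i => Φ z i 2) := by
  have hE : ContDiff ℝ ∞ (fun z => (Real.exp (u z / 2) : ℂ)) :=
    Complex.ofRealCLM.contDiff.comp (hu.div_const 2).exp
  have hEd := hE.differentiable (by simp)
  have hud := hu.differentiable (by simp)
  have hcol := fun j => (h.smooth_col j).differentiable (by simp)
  have e1 : dz (fun w i => Φ w i 2) = fun z => (Complex.I * lam⁻¹) •
      ((Real.exp (u z / 2) : ℂ) • (fun i => Φ z i 0)) := by
    funext z; ext i
    rw [dz_apply (hcol 2 z), h.eq_z, Matrix.mul_apply, Fin.sum_univ_three]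
    simp [frameU]; ring
  have e2 : dzbar (fun w i => Φ w i 0) z = (-dzbar (fun w => (u w : ℂ)) z / 2) • (fun i => Φ z i 0) +
      (Complex.I * lam * Real.exp (u z / 2)) • (fun i => Φ z i 2) := by
    ext i
    rw [dzbar_apply (hcol 0 z), h.eq_zbar, Matrix.mul_apply, Fin.sum_univ_three]
    simp [frameV]; ring
  have e3 := dzbar_ofReal_comp (g := fun t => Real.exp (t / 2)) (u := u) (z := z)
    ((Real.hasDerivAt_exp _).comp _ ((hasDerivAt_id _).div_const 2)) (hud z)
  have hEu : (Real.exp (u z) : ℂ) = Real.exp (u z / 2) * Real.exp (u z / 2) := by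
    rw [← Complex.ofReal_mul, ← Real.exp_add]; ring_nf
  have hl0 : lam ≠ 0 := by rintro rfl; simp at hlam
  rw [e1, dzbar_const_smul _ ((hEd z).fun_smul (hcol 0 z)), dzbar_smul (hEd z) (hcol 0 z), e2, e3,
    hEu]
  ext i
  simp only [Pi.smul_apply, Pi.add_apply, smul_eq_mul]
  push_cast
  have hll := inv_mul_cancel₀ hl0
  linear_combination (Complex.exp (u z / 2) * Complex.exp (u z / 2) * Φ z i 2) *
    (lam⁻¹ * lam * Complex.I_mul_I - hll)

omit h in
theorem frameU_add_frameV_of_max {z : ℂ} (hmax : ∀ w, u w ≤ u z) :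
    frameU u ψ lam z + frameV u ψ lam z = potentialD (Real.exp (u z)) (ψ z) lam := by
  have h0 : fderiv ℝ u z = 0 := by
    have : IsLocalMax u z := Filter.Eventually.of_forall hmax
    exact this.fderiv_eq_zero
  have h1 : fderiv ℝ (fun w => (u w : ℂ)) z = 0 := by
    -- If `u` is not differentiable at `z`, neither is its complexification, and `fderiv` takes its
    -- default value 0.
    by_cases hd : DifferentiableAt ℝ u z
    · have := (Complex.ofRealCLM.hasFDerivAt.comp z hd.hasFDerivAt).fderiv
      rw [h0, ContinuousLinearMap.comp_zero] at this
      exact this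
    · refine fderiv_zero_of_not_differentiableAt fun hc => hd ?_
      exact (Complex.reCLM.hasFDerivAt.comp z hc.hasFDerivAt).differentiableAt
  have h2 : Real.sqrt (Real.exp (u z)) = Real.exp (u z / 2) := (Real.exp_half _).symm
  ext i j
  fin_cases i <;> fin_cases j <;>
    simp [frameU, frameV, potentialD, dz, dzbar, h1, h2, -Complex.ofReal_exp, Real.exp_neg] <;> ring

variable (hlam : ‖lam‖ = 1) (hu : ContDiff ℝ ∞ u) (hut : ∀ (t : ℝ) z, u (t + z) = u z)
  (hψ : ∀ z, ψ z = ψ 0) (hmax : ∀ z, u z ≤ u 0)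
include hlam hu hut hψ hmax

omit h hlam hu in
theorem frameU_add_frameV_real (t : ℝ) :
    frameU u ψ lam t + frameV u ψ lam t = potentialD (Real.exp (u 0)) (ψ 0) lam := by
  have ht : u t = u 0 := by simpa using hut t 0
  rw [frameU_add_frameV_of_max (fun w => ht ▸ hmax w), ht, hψ]

/-- The frame equations multiply on the right by a matrix depending on z. Differentiating Φ(t + z) =
Φ(t) Φ(z) at t = 0 gives instead the constant matrix D on the left. -/
theorem fderiv_one_left (z : ℂ) (i j : Fin 3) : fderiv ℝ (fun w => Φ w i j) z 1 =
    (potentialD (Real.exp (u 0)) (ψ 0) lam * Φ z) i j := by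
  have hud := hu.differentiable (by simp)
  have h1 : HasDerivAt (fun t : ℝ => Φ (t + z) i j) (fderiv ℝ (fun w => Φ w i j) z 1) 0 := by
    have hi : HasDerivAt (fun t : ℝ => (t : ℂ) + z) 1 0 :=
      (Complex.ofRealCLM.hasDerivAt (x := 0)).add_const z
    have := (h.diff i j (((0 : ℝ) : ℂ) + z)).hasFDerivAt.comp_hasDerivAt (0 : ℝ) hi
    rw [Complex.ofReal_zero, zero_add] at this
    exact this
  have h2 : HasDerivAt (fun t : ℝ => (Φ t * Φ z) i j)
      ((potentialD (Real.exp (u 0)) (ψ 0) lam * Φ z) i j) 0 := by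
    have d := fun k => (h.hasDerivAt_real 0 i k).mul_const (Φ z k j)
    simp only [Complex.ofReal_zero, h.init, one_mul, frameU_add_frameV_of_max hmax] at d
    simp only [Matrix.mul_apply, Fin.sum_univ_three]
    exact ((d 0).add (d 1)).add (d 2)
  have h3 : (fun t : ℝ => Φ (t + z) i j) = fun t : ℝ => (Φ t * Φ z) i j := by
    funext t; rw [h.translate hlam hud hut hψ]
  rw [h3] at h1
  exact h1.unique h2

theorem fderiv_one_col (z : ℂ) : fderiv ℝ (fun w i => Φ w i 2) z 1 =
    potentialD (Real.exp (u 0)) (ψ 0) lam *ᵥ (fun i => Φ z i 2) := by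
  ext i
  rw [fderiv_apply_coord ((h.smooth_col 2).differentiable (by simp) z),
    h.fderiv_one_left hlam hu hut hψ hmax]
  rfl

omit hlam hu in
/-- `Φ` acts on eigenvectors of the generating matrix along the real axis by characters. -/
theorem mulVec_eigenvector {l : Fin 3 → ℂ} {d : ℝ}
    (hl : potentialD (Real.exp (u 0)) (ψ 0) lam *ᵥ l = (Complex.I * d) • l) (x : ℝ) :
    Φ x *ᵥ l = Complex.exp (Complex.I * d * x) • l := by
  have hX : ∀ t : ℝ, Φ t * (frameU u ψ lam t + frameV u ψ lam t) =
      Φ t * potentialD (Real.exp (u 0)) (ψ 0) lam := fun t => by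
    rw [frameU_add_frameV_real hut hψ hmax]
  ext i
  have hd : ∀ t : ℝ, HasDerivAt (fun t : ℝ => (Φ t *ᵥ l) i) (Complex.I * d * (Φ t *ᵥ l) i) t := by
    intro t
    have e : Complex.I * d * (Φ t *ᵥ l) i =
        ((Φ t * potentialD (Real.exp (u 0)) (ψ 0) lam) *ᵥ l) i := by
      rw [← Matrix.mulVec_mulVec, hl, Matrix.mulVec_smul]; rfl
    rw [e, ← hX]
    have D := fun j => (h.hasDerivAt_real t i j).mul_const (l j)
    simp only [Matrix.mulVec, dotProduct, Fin.sum_univ_three]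
    exact ((D 0).add (D 1)).add (D 2)
  -- Integrating factor: e^{-idt} Φ(t) l has zero derivative.
  have he : ∀ t : ℝ, HasDerivAt (fun t : ℝ => Complex.exp (-(Complex.I * d) * t))
      (Complex.exp (-(Complex.I * d) * t) * -(Complex.I * d)) t := fun t => by
    have := (Complex.ofRealCLM.hasDerivAt (x := t)).const_mul (-(Complex.I * d))
    simpa using this.cexp
  have hc : ∀ t : ℝ, HasDerivAt
      (fun t : ℝ => Complex.exp (-(Complex.I * d) * t) * (Φ t *ᵥ l) i) 0 t := fun t =>
    ((he t).mul (hd t)).congr_deriv (by ring)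
  have hcc := is_const_of_deriv_eq_zero (fun t => (hc t).differentiableAt)
    (fun t => (hc t).deriv) x 0
  simp only [Complex.ofReal_zero, mul_zero, Complex.exp_zero, h.init, Matrix.one_mulVec,
    one_mul] at hcc
  rw [Pi.smul_apply, smul_eq_mul, ← hcc, ← mul_assoc, ← Complex.exp_add]
  ring_nf
  simp

end IsExtendedFrame

/-- D is skew-Hermitian, so it can be moved onto the eigenvector in the product with F. -/
theorem herm_potentialD (a : ℝ) (p : ℂ) {lam : ℂ} (hlam : ‖lam‖ = 1) (X Y : Fin 3 → ℂ) :
    herm (potentialD a p lam *ᵥ X) Y = -herm X (potentialD a p lam *ᵥ Y) := by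
  have h3 := star_eq_inv_of_norm_eq_one hlam
  simp only [Complex.star_def] at h3
  simp only [herm_eq, potentialD, Matrix.mulVec, dotProduct, Fin.sum_univ_three]
  simp [h3]
  ring

/-! ### Lamé equations for the components of the lift. -/

namespace IsExtendedFrame

variable {u : ℂ → ℝ} {ψ : ℂ → ℂ} {lam : ℂ} {Φ : ℂ → Matrix (Fin 3) (Fin 3) ℂ}
  (h : IsExtendedFrame u ψ lam Φ)
  (hlam : ‖lam‖ = 1) (hu : ContDiff ℝ ∞ u) (hut : ∀ (t : ℝ) z, u (t + z) = u z)
  (hψ : ∀ z, ψ z = ψ 0) (hmax : ∀ z, u z ≤ u 0)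
include h hlam hu hut hψ hmax

/-- F_xx + F_yy = 4 F_zz̄ = -4 e^u F, and F_xx = D² F. -/
theorem fderiv_fderiv_I_col (z : ℂ) :
    fderiv ℝ (fun w => fderiv ℝ (fun w i => Φ w i 2) w Complex.I) z Complex.I =
      (-4 * Real.exp (u z) : ℂ) • (fun i => Φ z i 2) -
        potentialD (Real.exp (u 0)) (ψ 0) lam *ᵥ potentialD (Real.exp (u 0)) (ψ 0) lam *ᵥ
          (fun i => Φ z i 2) := by
  have hF := h.smooth_col 2
  have h1 := flatLaplacian_eq hF z
  rw [h.dzbar_dz_col hlam hu, flatLaplacian,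
    show (fun w => fderiv ℝ (fun w i => Φ w i 2) w 1) = _ from
      funext (h.fderiv_one_col hlam hu hut hψ hmax),
    fderiv_mulVec _ (hF.differentiable (by simp) z), h.fderiv_one_col hlam hu hut hψ hmax] at h1
  rw [eq_sub_iff_add_eq', h1, smul_smul]
  congr 1; ring

/-- Along the imaginary axis, the components of `F` in the eigenvectors of the generating matrix
solve a Lamé equation. -/
theorem herm_col_eq {l : Fin 3 → ℂ} {d c : ℝ}
    (hl : potentialD (Real.exp (u 0)) (ψ 0) lam *ᵥ l = (Complex.I * d) • l) {g g' : ℝ → ℝ}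
    (hg : ∀ y, HasDerivAt g (g' y) y)
    (hg' : ∀ y : ℝ, HasDerivAt g' ((d ^ 2 - 4 * Real.exp (u (y * Complex.I))) * g y) y)
    (h0 : star (l 2) = c * g 0)
    (h1 : -Real.exp (u 0 / 2) * (lam⁻¹ * star (l 0) - lam * star (l 1)) = c * g' 0) (y : ℝ) :
    herm (fun i => Φ (y * Complex.I) i 2) l = c * g y := by
  have hF := h.smooth_col 2
  have hFd := hF.differentiable (by simp)
  have hFy := contDiff_fderiv_apply hF Complex.I
  have hline : ∀ t : ℝ, HasDerivAt (fun t : ℝ => (t : ℂ) * Complex.I) Complex.I t := fun t => by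
    simpa using (Complex.ofRealCLM.hasDerivAt (x := t)).mul_const Complex.I
  have hherm : ∀ (G : ℝ → Fin 3 → ℂ) (G' : Fin 3 → ℂ) (t : ℝ), HasDerivAt G G' t →
      HasDerivAt (fun t => herm (G t) l) (herm G' l) t := by
    intro G G' t hG
    have e := fun j => (hasDerivAt_pi.1 hG j).mul_const (star (l j))
    simp only [herm_eq]
    exact ((e 0).add (e 1)).add (e 2)
  have hH : ∀ t : ℝ, HasDerivAt (fun t : ℝ => herm (fun i => Φ (t * Complex.I) i 2) l)
      (herm (fderiv ℝ (fun w i => Φ w i 2) (t * Complex.I) Complex.I) l) t := fun t =>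
    hherm _ _ t ((hFd _).hasFDerivAt.comp_hasDerivAt t (hline t))
  have hH' : ∀ t : ℝ, HasDerivAt
      (fun t : ℝ => herm (fderiv ℝ (fun w i => Φ w i 2) (t * Complex.I) Complex.I) l)
      (((d ^ 2 - 4 * Real.exp (u (t * Complex.I)) : ℝ) : ℂ) *
        herm (fun i => Φ (t * Complex.I) i 2) l) t := fun t => by
    have e := hherm _ _ t
      ((hFy.differentiable (by simp) (t * Complex.I)).hasFDerivAt.comp_hasDerivAt t (hline t))
    refine e.congr_deriv ?_
    rw [h.fderiv_fderiv_I_col hlam hu hut hψ hmax, herm_sub_left, herm_smul_left,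
      herm_potentialD _ _ hlam, herm_potentialD _ _ hlam, hl, Matrix.mulVec_smul, hl,
      herm_smul_right, herm_smul_right]
    simp
    linear_combination (-(d : ℂ) ^ 2 * herm (fun i => Φ (t * Complex.I) i 2) l) * Complex.I_mul_I
  have hc : ∀ (G : ℝ → ℝ) (G' t : ℝ), HasDerivAt G G' t →
      HasDerivAt (fun t => (c * G t : ℂ)) (c * G') t := fun G G' t hG =>
    (hG.ofReal_comp).const_mul (c : ℂ)
  have key := eq_zero_of_second_order (E := ℂ)
    (q := fun t => d ^ 2 - 4 * Real.exp (u (t * Complex.I)))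
    (C := d ^ 2 + 4 * Real.exp (u 0)) ?_
    (fun t => (hH t).sub (hc _ _ t (hg t))) (fun t => ((hH' t).sub (hc _ _ t (hg' t))).congr_deriv ?_)
    ?_ ?_ y
  · exact sub_eq_zero.1 key
  · intro t
    have hw := Real.exp_le_exp.2 (hmax (t * Complex.I))
    have hw2 := Real.exp_pos (u (t * Complex.I))
    rw [abs_le]
    constructor <;> nlinarith [sq_nonneg d]
  · simp; ring
  · simp [h.init, herm_eq]
    exact sub_eq_zero.2 h0
  · simp only [Complex.ofReal_zero, zero_mul]
    -- F_z and F_z̄ at 0 are the third columns of the coefficient matrices, so F_y(0) = i (F_z -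
    -- F_z̄)(0) = -e^{u(0)/2} (λ⁻¹, -λ, 0). This is the source of the slope hypothesis `h1`.
    have e1 : dz (fun w i => Φ w i 2) 0 = ![Complex.I * lam⁻¹ * Real.exp (u 0 / 2), 0, 0] := by
      ext i
      rw [dz_apply (hFd 0), h.eq_z, h.init, one_mul]
      fin_cases i <;> simp [frameU]; ring
    have e2 : dzbar (fun w i => Φ w i 2) 0 = ![0, Complex.I * lam * Real.exp (u 0 / 2), 0] := by
      ext i
      rw [dzbar_apply (hFd 0), h.eq_zbar, h.init, one_mul]
      fin_cases i <;> simp [frameV]; ring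
    rw [fderiv_I_eq_dz_sub_dzbar, e1, e2, ← h1, herm_eq]
    simp
    linear_combination (Complex.exp (u 0 / 2) *
      (lam⁻¹ * (starRingEnd ℂ) (l 0) - lam * (starRingEnd ℂ) (l 1))) * Complex.I_mul_I

end IsExtendedFrame

/-! ### Simplified coefficients of the components. -/

section Constants

variable {a₁ a₂ a₃ p : ℝ} (H : IsRootTriple a₁ a₂ a₃ p)
include H

theorem IsRootTriple.pos₁ : 0 < a₁ := H.pos₂.trans H.lt

/-- The root relations give a₁³ - p² = a₁ (a₁ - a₂)(a₁ + a₃), and a₁ - a₂ cancels. The other two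
coefficients simplify through similar factorizations. -/
theorem IsRootTriple.coeff₁ :
    a₁ * Real.sqrt ((a₁ - a₂) / (a₁ ^ 3 - p ^ 2)) = Real.sqrt (a₁ / (a₁ + a₃)) := by
  obtain ⟨h2, h3, hlt, hp, hsq, hmul⟩ := H
  have h1 := h2.trans hlt
  have e : a₁ ^ 3 - p ^ 2 = a₁ * (a₁ - a₂) * (a₁ + a₃) := by
    rw [hsq]; linear_combination a₁ * hmul
  have hd : a₁ - a₂ ≠ 0 := by linarith
  have e2 : a₁ / (a₁ + a₃) = a₁ ^ 2 * ((a₁ - a₂) / (a₁ ^ 3 - p ^ 2)) := by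
    rw [e]; field_simp
  rw [e2, Real.sqrt_mul (sq_nonneg _), Real.sqrt_sq h1.le]

theorem IsRootTriple.coeff₂ :
    a₂ * Real.sqrt ((a₁ - a₂) / (p ^ 2 - a₂ ^ 3)) = Real.sqrt (a₁ / (2 * a₁ - a₃)) := by
  obtain ⟨h2, h3, hlt, hp, hsq, hmul⟩ := H
  have h1 := h2.trans hlt
  have hs : 0 < a₂ - a₃ := by
    by_contra hcon
    nlinarith [mul_pos h2 h3]
  have e : (p ^ 2 - a₂ ^ 3) * a₁ = a₂ ^ 2 * ((a₁ - a₂) * (2 * a₁ - a₃)) := by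
    rw [hsq]; linear_combination (-2 * a₁ ^ 2 + 2 * a₁ * a₂ - a₂ ^ 2) * hmul
  have hd : 0 < a₁ - a₂ := by linarith
  have hd2 : 0 < 2 * a₁ - a₃ := by linarith
  have hpos : 0 < p ^ 2 - a₂ ^ 3 := by
    have : 0 < (p ^ 2 - a₂ ^ 3) * a₁ := by rw [e]; positivity
    exact pos_of_mul_pos_left this h1.le
  have e2 : a₁ / (2 * a₁ - a₃) = a₂ ^ 2 * ((a₁ - a₂) / (p ^ 2 - a₂ ^ 3)) := by
    rw [div_eq_iff hd2.ne']
    field_simp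
    linear_combination e
  rw [e2, Real.sqrt_mul (sq_nonneg _), Real.sqrt_sq h2.le]

theorem IsRootTriple.coeff₃ :
    a₃ * Real.sqrt ((a₁ + a₃) / (p ^ 2 + a₃ ^ 3)) = Real.sqrt (a₁ / (2 * a₁ + a₂)) := by
  obtain ⟨h2, h3, hlt, hp, hsq, hmul⟩ := H
  have h1 := h2.trans hlt
  have e : (p ^ 2 + a₃ ^ 3) * a₁ = a₃ ^ 2 * ((a₁ + a₃) * (2 * a₁ + a₂)) := by
    rw [hsq]; linear_combination (-2 * a₁ ^ 2 - 2 * a₁ * a₃ - a₃ ^ 2) * hmul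
  have hpos : 0 < p ^ 2 + a₃ ^ 3 := by positivity
  have e2 : a₁ / (2 * a₁ + a₂) = a₃ ^ 2 * ((a₁ + a₃) / (p ^ 2 + a₃ ^ 3)) := by
    rw [div_eq_iff (by positivity)]
    field_simp
    linear_combination e
  rw [e2, Real.sqrt_mul (sq_nonneg _), Real.sqrt_sq h3.le]

end Constants

/-! ### Eigenvectors of the generating matrix. -/

section Eigenvectors

variable {lam : ℂ} (hlam : ‖lam‖ = 1) {a P : ℝ} (ha : 0 < a)
include hlam ha

/-- With ψ = λ³P and P real, conjugation by diag(λ⁻¹, λ, 1) makes D symmetric under exchange of the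
first two coordinates. The antisymmetric line is then an eigenspace, and the symmetric plane carries
the other two eigenvectors. -/
theorem potentialD_mulVec_antisymmetric (σ : ℂ) :
    potentialD a (lam ^ 3 * P) lam *ᵥ ![-(lam⁻¹ * σ), lam * σ, 0] =
      (Complex.I * (P / a : ℝ)) • ![-(lam⁻¹ * σ), lam * σ, 0] := by
  have hl0 : lam ≠ 0 := by rintro rfl; simp at hlam
  have hs := star_eq_inv_of_norm_eq_one hlam
  have ha' : (a : ℂ) ≠ 0 := by exact_mod_cast ha.ne'
  simp only [Complex.star_def] at hs
  ext i
  fin_cases i <;>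
    simp [potentialD, Matrix.mulVec, dotProduct, Fin.sum_univ_three, hs] <;> (field_simp; try ring)

theorem potentialD_mulVec_symmetric {d t : ℝ} (c : ℂ) (ht : d = 2 * Real.sqrt a * t)
    (hd : d ^ 2 = 2 * a - P * d / a) :
    potentialD a (lam ^ 3 * P) lam *ᵥ ![c * (lam⁻¹ * t), c * (lam * t), c] =
      (Complex.I * d) • ![c * (lam⁻¹ * t), c * (lam * t), c] := by
  have hl0 : lam ≠ 0 := by rintro rfl; simp at hlam
  have hs := star_eq_inv_of_norm_eq_one hlam
  have ha' : (a : ℂ) ≠ 0 := by exact_mod_cast ha.ne'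
  have hq : Real.sqrt a ^ 2 = a := Real.sq_sqrt ha.le
  have hq0 : 0 < Real.sqrt a := Real.sqrt_pos.2 ha
  -- The first coordinate of the eigenvector equation; multiplied by 2√a it becomes the quadratic
  -- equation for d.
  have key : a * Real.sqrt a - P * t = a * d * t := by
    have h1 : 2 * Real.sqrt a * (a * Real.sqrt a - P * t - a * d * t) = 0 := by
      have e1 : a * d ^ 2 = 2 * a ^ 2 - P * d := by rw [hd]; field_simp
      calc _ = 2 * a * Real.sqrt a ^ 2 - P * (2 * Real.sqrt a * t) -
            a * d * (2 * Real.sqrt a * t) := by ring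
        _ = 0 := by rw [← ht, hq]; linear_combination -e1
    have := (mul_eq_zero.1 h1).resolve_left (by positivity)
    linarith
  have keyC : (a : ℂ) * (Real.sqrt a : ℂ) - P * t = a * d * t := by exact_mod_cast key
  have htC : (d : ℂ) = 2 * (Real.sqrt a : ℂ) * t := by exact_mod_cast ht
  simp only [Complex.star_def] at hs
  ext i
  fin_cases i
  · simp [potentialD, Matrix.mulVec, dotProduct, Fin.sum_univ_three, hs]
    field_simp
    linear_combination c * keyC
  · simp [potentialD, Matrix.mulVec, dotProduct, Fin.sum_univ_three, hs]
    field_simp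
    linear_combination c * keyC
  · simp [potentialD, Matrix.mulVec, dotProduct, Fin.sum_univ_three]
    field_simp
    linear_combination -c * htC

end Eigenvectors

/-- Since 2 r² k² = 4 (a₁ - a₂), the equation h'' = (d² - 4w) h reads h'' = (2 r² k² sn² + d² - 4a₁)
h, and d₁, d₂, d₃ are the values for which sn, cn, dn solve it. The slope F_y(0) is antisymmetric up
to λ and F(0) = e₃ is symmetric, so the antisymmetric eigenvector takes sn and the symmetric ones cn
and dn. Real translations multiply each component by its character. -/
theorem IsExtendedFrame.explicit_col {u : ℂ → ℝ} {ψ : ℂ → ℂ} {lam : ℂ}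
    {Φ : ℂ → Matrix (Fin 3) (Fin 3) ℂ} (h : IsExtendedFrame u ψ lam Φ)
    (hlam : ‖lam‖ = 1) (hu : ContDiff ℝ ∞ u) (hut : ∀ (t : ℝ) z, u (t + z) = u z)
    (hψ : ∀ z, ψ z = ψ 0) (hmax : ∀ z, u z ≤ u 0) {a₁ a₂ a₃ p P k r : ℝ}
    (ha₁ : a₁ = Real.exp (u 0)) (H : IsRootTriple a₁ a₂ a₃ p)
    (hP : ψ 0 = lam ^ 3 * P) (hPp : P ^ 2 = p ^ 2)
    (hk : k ^ 2 * (a₁ + a₃) = a₁ - a₂) (hr : r ^ 2 = 2 * (a₁ + a₃)) (hr0 : 0 < r)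
    (hw : ∀ y : ℝ, Real.exp (u (y * Complex.I)) = a₁ - (a₁ - a₂) * jacobiSn (r * y) k ^ 2) :
    ∃ l₁ l₂ l₃ : Fin 3 → ℂ, herm l₁ l₁ = 1 ∧ herm l₂ l₂ = 1 ∧ herm l₃ l₃ = 1 ∧
      herm l₁ l₂ = 0 ∧ herm l₁ l₃ = 0 ∧ herm l₂ l₃ = 0 ∧
      potentialD a₁ (ψ 0) lam *ᵥ l₁ = (Complex.I * (P / a₁ : ℝ)) • l₁ ∧
      potentialD a₁ (ψ 0) lam *ᵥ l₂ = (Complex.I * (P / a₂ : ℝ)) • l₂ ∧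
      potentialD a₁ (ψ 0) lam *ᵥ l₃ = (Complex.I * (-P / a₃ : ℝ)) • l₃ ∧
      ∀ x y : ℝ, (fun i => Φ (x + y * Complex.I) i 2) =
        ((Real.sqrt (a₁ / (a₁ + a₃)) : ℝ) * jacobiSn (r * y) k *
          Complex.exp (Complex.I * (P / a₁ : ℝ) * x)) • l₁ +
        ((Real.sqrt (a₁ / (2 * a₁ - a₃)) : ℝ) * jacobiCn (r * y) k *
          Complex.exp (Complex.I * (P / a₂ : ℝ) * x)) • l₂ +
        ((Real.sqrt (a₁ / (2 * a₁ + a₂)) : ℝ) * jacobiDn (r * y) k *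
          Complex.exp (Complex.I * (-P / a₃ : ℝ) * x)) • l₃ := by
  have h1 := H.pos₁
  obtain ⟨h2, h3, hlt, hp, hsq, hmul⟩ := H
  have hl0 : lam ≠ 0 := by rintro rfl; simp at hlam
  have hstar := star_eq_inv_of_norm_eq_one hlam
  have hstar' : star lam⁻¹ = lam := by rw [← hstar, star_star]
  have sR : ∀ t : ℝ, star (t : ℂ) = t := fun t => Complex.conj_ofReal t
  have hk1 : k ^ 2 < 1 := by nlinarith
  have hq2 : Real.sqrt a₁ ^ 2 = a₁ := Real.sq_sqrt h1.le
  have hq0 : 0 < Real.sqrt a₁ := Real.sqrt_pos.2 h1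
  have ha3 : a₃ < a₁ := by nlinarith
  set d₁ := P / a₁ with hd₁
  set d₂ := P / a₂ with hd₂
  set d₃ := -P / a₃ with hd₃
  have hd1 : d₁ ^ 2 = 2 * (a₂ - a₃) := by
    rw [hd₁, div_pow, hPp, hsq]; field_simp
  have hd2 : d₂ ^ 2 = 2 * (a₁ - a₃) := by
    rw [hd₂, div_pow, hPp, hsq, div_eq_iff (by positivity)]
    linear_combination (2 * a₂ - 2 * a₁) * hmul
  have hd3 : d₃ ^ 2 = 2 * (a₁ + a₂) := by
    rw [hd₃, div_pow, neg_sq, hPp, hsq, div_eq_iff (by positivity)]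
    linear_combination (-2 * a₃ - 2 * a₁) * hmul
  have hPd2 : P * d₂ / a₁ = 2 * a₃ := by
    rw [hd₂, div_eq_iff h1.ne', mul_div_assoc', div_eq_iff h2.ne', ← sq, hPp, hsq]
    linear_combination (-2 * a₁) * hmul
  have hPd3 : P * d₃ / a₁ = -2 * a₂ := by
    rw [hd₃, div_eq_iff h1.ne', mul_div_assoc', div_eq_iff h3.ne']
    linear_combination -hPp - hsq + (2 * a₁) * hmul
  have hd23 : d₂ * d₃ = -2 * a₁ := by
    rw [hd₂, hd₃, div_mul_div_comm, div_eq_iff (by positivity)]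
    linear_combination -hPp - hsq + (2 * a₁) * hmul
  set c₁ := Real.sqrt (a₁ / (a₁ + a₃)) with hc₁
  set c₂ := Real.sqrt (a₁ / (2 * a₁ - a₃)) with hc₂
  set c₃ := Real.sqrt (a₁ / (2 * a₁ + a₂)) with hc₃
  have hc2 : c₂ ^ 2 * (2 * a₁ - a₃) = a₁ := by
    have : 0 < 2 * a₁ - a₃ := by linarith
    rw [hc₂, Real.sq_sqrt (by positivity), div_mul_cancel₀ _ this.ne']
  have hc3 : c₃ ^ 2 * (2 * a₁ + a₂) = a₁ := by
    rw [hc₃, Real.sq_sqrt (by positivity)]; field_simp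
  -- As sn vanishes at 0, c₁ is fixed by the initial slope of the first component, which is √2 √a₁.
  have hc1 : c₁ * r = Real.sqrt 2 * Real.sqrt a₁ := by
    rw [hc₁, ← Real.sqrt_sq hr0.le, hr, ← Real.sqrt_mul (by positivity),
      ← Real.sqrt_mul (by positivity)]
    congr 1; field_simp
  set t₂ := d₂ / (2 * Real.sqrt a₁) with ht₂
  set t₃ := d₃ / (2 * Real.sqrt a₁) with ht₃
  have ht2 : d₂ = 2 * Real.sqrt a₁ * t₂ := by rw [ht₂]; field_simp
  have ht3 : d₃ = 2 * Real.sqrt a₁ * t₃ := by rw [ht₃]; field_simp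
  have ht22 : t₂ ^ 2 * (2 * a₁) = a₁ - a₃ := by
    rw [ht2] at hd2; linear_combination hd2 / 2 - 2 * t₂ ^ 2 * hq2
  have ht33 : t₃ ^ 2 * (2 * a₁) = a₁ + a₂ := by
    rw [ht3] at hd3; linear_combination hd3 / 2 - 2 * t₃ ^ 2 * hq2
  -- Orthogonality of l₂ and l₃, coming from d₂ d₃ = -2a₁.
  have ht23 : 2 * (t₂ * t₃) = -1 := by
    have : a₁ * (2 * (t₂ * t₃) + 1) = 0 := by
      rw [ht2, ht3] at hd23; linear_combination hd23 / 2 - 2 * t₂ * t₃ * hq2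
    have := (mul_eq_zero.1 this).resolve_left h1.ne'
    linarith
  have hn2 : c₂ ^ 2 * (2 * t₂ ^ 2 + 1) = 1 := by
    have : a₁ * (c₂ ^ 2 * (2 * t₂ ^ 2 + 1) - 1) = 0 := by
      linear_combination c₂ ^ 2 * ht22 + hc2
    have := (mul_eq_zero.1 this).resolve_left h1.ne'
    linarith
  have hn3 : c₃ ^ 2 * (2 * t₃ ^ 2 + 1) = 1 := by
    have : a₁ * (c₃ ^ 2 * (2 * t₃ ^ 2 + 1) - 1) = 0 := by
      linear_combination c₃ ^ 2 * ht33 + hc3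
    have := (mul_eq_zero.1 this).resolve_left h1.ne'
    linarith
  -- Normalizes l₁. For l₂ and l₃ the normalizing factors are c₂ and c₃ themselves: the third
  -- coordinate of l_j is the initial value of its component, as F(0) = e₃ and cn, dn equal 1 at 0.
  set σ : ℝ := (Real.sqrt 2)⁻¹ with hσ
  have hσ2 : 2 * σ ^ 2 = 1 := by rw [hσ, inv_pow, Real.sq_sqrt zero_le_two]; norm_num
  have hσ3 : Real.sqrt 2 = 2 * σ := by
    have h22 : Real.sqrt 2 ^ 2 = 2 := Real.sq_sqrt zero_le_two
    rw [hσ]; field_simp; exact h22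
  have hσ3' : ((Real.sqrt 2 : ℝ) : ℂ) = 2 * σ := by exact_mod_cast hσ3
  let l₁ : Fin 3 → ℂ := ![-(lam⁻¹ * σ), lam * σ, 0]
  let l₂ : Fin 3 → ℂ := ![c₂ * (lam⁻¹ * t₂), c₂ * (lam * t₂), c₂]
  let l₃ : Fin 3 → ℂ := ![c₃ * (lam⁻¹ * t₃), c₃ * (lam * t₃), c₃]
  have E1 : potentialD a₁ (ψ 0) lam *ᵥ l₁ = (Complex.I * d₁) • l₁ := by
    rw [hP]; exact potentialD_mulVec_antisymmetric hlam h1 _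
  have E2 : potentialD a₁ (ψ 0) lam *ᵥ l₂ = (Complex.I * d₂) • l₂ := by
    rw [hP]; exact potentialD_mulVec_symmetric hlam h1 _ ht2 (by rw [hPd2, hd2]; ring)
  have E3 : potentialD a₁ (ψ 0) lam *ᵥ l₃ = (Complex.I * d₃) • l₃ := by
    rw [hP]; exact potentialD_mulVec_symmetric hlam h1 _ ht3 (by rw [hPd3, hd3]; ring)
  have hll := mul_inv_cancel₀ hl0
  have N1 : herm l₁ l₁ = 1 := by
    simp only [herm_eq, l₁, Matrix.cons_val, star_neg, star_mul', star_zero, hstar, hstar', sR]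
    have : (2 * σ ^ 2 : ℂ) = 1 := by exact_mod_cast hσ2
    linear_combination 2 * (σ : ℂ) ^ 2 * hll + this
  have N2 : herm l₂ l₂ = 1 := by
    simp only [herm_eq, l₂, Matrix.cons_val, star_mul', hstar, hstar', sR]
    have : (c₂ ^ 2 * (2 * t₂ ^ 2 + 1) : ℂ) = 1 := by exact_mod_cast hn2
    linear_combination 2 * (c₂ : ℂ) ^ 2 * t₂ ^ 2 * hll + this
  have N3 : herm l₃ l₃ = 1 := by
    simp only [herm_eq, l₃, Matrix.cons_val, star_mul', hstar, hstar', sR]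
    have : (c₃ ^ 2 * (2 * t₃ ^ 2 + 1) : ℂ) = 1 := by exact_mod_cast hn3
    linear_combination 2 * (c₃ : ℂ) ^ 2 * t₃ ^ 2 * hll + this
  have O12 : herm l₁ l₂ = 0 := by
    simp only [herm_eq, l₁, l₂, Matrix.cons_val, star_mul', hstar, hstar', sR]
    ring
  have O13 : herm l₁ l₃ = 0 := by
    simp only [herm_eq, l₁, l₃, Matrix.cons_val, star_mul', hstar, hstar', sR]
    ring
  have O23 : herm l₂ l₃ = 0 := by
    simp only [herm_eq, l₂, l₃, Matrix.cons_val, star_mul', hstar, hstar', sR]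
    have : (2 * (t₂ * t₃) : ℂ) = -1 := by exact_mod_cast ht23
    linear_combination 2 * (c₂ : ℂ) * c₃ * t₂ * t₃ * hll + c₂ * c₃ * this
  refine ⟨l₁, l₂, l₃, N1, N2, N3, O12, O13, O23, E1, E2, E3, ?_⟩
  have hlin : ∀ y : ℝ, HasDerivAt (fun y => r * y) r y := fun y => by
    simpa using (hasDerivAt_id y).const_mul r
  have hsn : ∀ y, HasDerivAt (fun y => jacobiSn (r * y) k)
      (jacobiCn (r * y) k * jacobiDn (r * y) k * r) y := fun y =>
    (hasDerivAt_jacobiSn hk1 (r * y)).comp y (hlin y)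
  have hcn : ∀ y, HasDerivAt (fun y => jacobiCn (r * y) k)
      (-jacobiSn (r * y) k * jacobiDn (r * y) k * r) y := fun y =>
    (hasDerivAt_jacobiCn hk1 (r * y)).comp y (hlin y)
  have hdn : ∀ y, HasDerivAt (fun y => jacobiDn (r * y) k)
      (-k ^ 2 * jacobiSn (r * y) k * jacobiCn (r * y) k * r) y := fun y =>
    (hasDerivAt_jacobiDn hk1 (r * y)).comp y (hlin y)
  have hexp2 : Real.exp (u 0 / 2) = Real.sqrt a₁ := by rw [ha₁, Real.exp_half]
  have C1 : ∀ y : ℝ, herm (fun i => Φ (y * Complex.I) i 2) l₁ = c₁ * jacobiSn (r * y) k := by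
    refine h.herm_col_eq hlam hu hut hψ hmax (d := d₁) (ha₁ ▸ E1) hsn (fun y => ?_) ?_ ?_
    · refine (((hcn y).mul (hdn y)).mul_const r).congr_deriv ?_
      rw [hw, hd1]
      have e1 := jacobiCn_sq (k := k) (r * y)
      have e2 := jacobiDn_sq hk1 (r * y)
      generalize jacobiSn (r * y) k = S at *
      generalize jacobiCn (r * y) k = c at *
      generalize jacobiDn (r * y) k = d at *
      linear_combination (-S * r ^ 2) * e2 + (-S * r ^ 2 * k ^ 2) * e1 +
        (-S * (1 + k ^ 2 - 2 * k ^ 2 * S ^ 2)) * hr + (-2 * S * (1 - 2 * S ^ 2)) * hk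
    · simp [l₁, jacobiSn_zero hk1]
    · simp only [l₁, Matrix.cons_val, star_neg, star_mul', hstar, hstar', sR, jacobiCn_zero hk1,
        jacobiDn_zero hk1, mul_zero, hexp2]
      have e1 : (c₁ * r : ℂ) = 2 * σ * Real.sqrt a₁ := by rw [← hσ3']; exact_mod_cast hc1
      push_cast
      linear_combination 2 * (Real.sqrt a₁ : ℂ) * σ * hll - e1
  have C2 : ∀ y : ℝ, herm (fun i => Φ (y * Complex.I) i 2) l₂ = c₂ * jacobiCn (r * y) k := by
    refine h.herm_col_eq hlam hu hut hψ hmax (d := d₂) (ha₁ ▸ E2) hcn (fun y => ?_) ?_ ?_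
    · refine (((hsn y).fun_neg.mul (hdn y)).mul_const r).congr_deriv ?_
      rw [hw, hd2]
      have e1 := jacobiCn_sq (k := k) (r * y)
      have e2 := jacobiDn_sq hk1 (r * y)
      generalize jacobiSn (r * y) k = S at *
      generalize jacobiCn (r * y) k = c at *
      generalize jacobiDn (r * y) k = d at *
      linear_combination (-c * r ^ 2) * e2 + (-c * (1 - 2 * k ^ 2 * S ^ 2)) * hr + (4 * c * S ^ 2) * hk
    · simp [l₂, jacobiCn_zero hk1]
    · simp only [l₂, Matrix.cons_val, star_mul', hstar, hstar', sR, jacobiSn_zero hk1, mul_zero]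
      push_cast
      ring
  have C3 : ∀ y : ℝ, herm (fun i => Φ (y * Complex.I) i 2) l₃ = c₃ * jacobiDn (r * y) k := by
    refine h.herm_col_eq hlam hu hut hψ hmax (d := d₃) (ha₁ ▸ E3) hdn (fun y => ?_) ?_ ?_
    · refine ((((hsn y).const_mul (-k ^ 2)).mul (hcn y)).mul_const r).congr_deriv ?_
      rw [hw, hd3]
      have e1 := jacobiCn_sq (k := k) (r * y)
      have e2 := jacobiDn_sq hk1 (r * y)
      generalize jacobiSn (r * y) k = S at *
      generalize jacobiCn (r * y) k = c at *
      generalize jacobiDn (r * y) k = d at *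
      linear_combination (-k ^ 2 * d * r ^ 2) * e1 + (-k ^ 2 * d * (1 - 2 * S ^ 2)) * hr +
        (-2 * d * (1 - 2 * S ^ 2)) * hk
    · simp [l₃, jacobiDn_zero hk1]
    · simp only [l₃, Matrix.cons_val, star_mul', hstar, hstar', sR, jacobiSn_zero hk1, mul_zero]
      push_cast
      ring
  have hF : ∀ y : ℝ, (fun i => Φ (y * Complex.I) i 2) = ((c₁ * jacobiSn (r * y) k : ℂ)) • l₁ +
      ((c₂ * jacobiCn (r * y) k : ℂ)) • l₂ + ((c₃ * jacobiDn (r * y) k : ℂ)) • l₃ := by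
    intro y
    refine eq_of_herm_eq (e := ![l₁, l₂, l₃]) (m := fun _ => 1) (by simp) ?_ ?_
    · intro i j
      fin_cases i <;> fin_cases j <;> simp [N1, N2, N3, O12, O13, O23, herm_swap_eq_zero O12,
        herm_swap_eq_zero O13, herm_swap_eq_zero O23]
    · intro i
      fin_cases i <;> simp [herm_add_left, herm_smul_left, C1, C2, C3, N1, N2, N3, O12, O13, O23,
        herm_swap_eq_zero O12, herm_swap_eq_zero O13, herm_swap_eq_zero O23]
  intro x y
  have e1 : (fun i => Φ (x + y * Complex.I) i 2) = Φ x *ᵥ (fun i => Φ (y * Complex.I) i 2) := by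
    rw [h.translate hlam (hu.differentiable (by simp)) hut hψ]; rfl
  rw [e1, hF, Matrix.mulVec_add, Matrix.mulVec_add, Matrix.mulVec_smul, Matrix.mulVec_smul,
    Matrix.mulVec_smul, h.mulVec_eigenvector hut hψ hmax (ha₁ ▸ E1),
    h.mulVec_eigenvector hut hψ hmax (ha₁ ▸ E2), h.mulVec_eigenvector hut hψ hmax (ha₁ ▸ E3),
    smul_smul, smul_smul, smul_smul]

/-- The group of periods of `f`. -/
def periodSubgroup (f : ℂ → CP2) : AddSubgroup ℂ where
  carrier := {l | ∀ z, f (z + l) = f z}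
  zero_mem' := fun z => by rw [add_zero]
  add_mem' := fun {a b} ha hb z => by rw [← add_assoc, hb, ha]
  neg_mem' := fun {a} ha z => by rw [← ha (z + -a), neg_add_cancel_right]

theorem descendsTo_of_le {f : ℂ → CP2} {L : AddSubgroup ℂ} (h : L ≤ periodSubgroup f) :
    DescendsTo f L := by
  refine ⟨Quotient.lift f fun a b hab => ?_, fun z => rfl⟩
  have h1 := h (QuotientAddGroup.leftRel_apply.1 hab) a
  rw [← h1]; congr 1; ring

/-! ### Periods of f read off from the lift. -/

theorem IsCanonicalLift.eq_iff {f : ℂ → CP2} {u : ℂ → ℝ} {ψ : ℂ → ℂ} {lam : ℂ}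
    {F : ℂ → Fin 3 → ℂ} (h : IsCanonicalLift f u ψ lam F) (z w : ℂ) :
    f z = f w ↔ ∃ μ : ℂ, F z = μ • F w := by
  obtain ⟨-, A, -, hA⟩ := h
  obtain ⟨hz, hz'⟩ := hA z
  obtain ⟨hw, hw'⟩ := hA w
  rw [hz', hw', smul_left_cancel_iff, Projectivization.mk_eq_mk_iff']
  exact ⟨fun ⟨a, ha⟩ => ⟨a, ha.symm⟩, fun ⟨a, ha⟩ => ⟨a, ha.symm⟩⟩

theorem eq_of_smul_combination {l₁ l₂ l₃ : Fin 3 → ℂ} (N1 : herm l₁ l₁ = 1) (N2 : herm l₂ l₂ = 1)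
    (N3 : herm l₃ l₃ = 1) (O12 : herm l₁ l₂ = 0) (O13 : herm l₁ l₃ = 0) (O23 : herm l₂ l₃ = 0)
    {α₁ α₂ α₃ e₁ e₂ e₃ μ : ℂ} (h1 : α₁ ≠ 0) (h2 : α₂ ≠ 0) (h3 : α₃ ≠ 0)
    (h : (α₁ * e₁) • l₁ + (α₂ * e₂) • l₂ + (α₃ * e₃) • l₃ = μ • (α₁ • l₁ + α₂ • l₂ + α₃ • l₃)) :
    e₁ = μ ∧ e₂ = μ ∧ e₃ = μ := by
  have O21 := herm_swap_eq_zero O12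
  have O31 := herm_swap_eq_zero O13
  have O32 := herm_swap_eq_zero O23
  have k1 := congrArg (fun X => herm X l₁) h
  have k2 := congrArg (fun X => herm X l₂) h
  have k3 := congrArg (fun X => herm X l₃) h
  simp only [herm_add_left, herm_smul_left, N1, N2, N3, O12, O13, O23, O21, O31, O32, mul_zero,
    mul_one, add_zero, zero_add] at k1 k2 k3
  refine ⟨mul_left_cancel₀ h1 ?_, mul_left_cancel₀ h2 ?_, mul_left_cancel₀ h3 ?_⟩
  · rw [k1, mul_comm]
  · rw [k2, mul_comm]
  · rw [k3, mul_comm]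

theorem exp_I_mul_eq_iff (a b τ : ℝ) :
    Complex.exp (Complex.I * a * τ) = Complex.exp (Complex.I * b * τ) ↔
      ∃ n : ℤ, (a - b) * τ = n * (2 * Real.pi) := by
  rw [Complex.exp_eq_exp_iff_exists_int]
  refine exists_congr fun n => ?_
  constructor
  · intro h
    have h' : Complex.I * (((a - b) * τ : ℝ) : ℂ) = Complex.I * ((n * (2 * Real.pi) : ℝ) : ℂ) := by
      push_cast; linear_combination h
    exact_mod_cast mul_left_cancel₀ Complex.I_ne_zero h'
  · intro h
    have h' : (((a - b) * τ : ℝ) : ℂ) = ((n * (2 * Real.pi) : ℝ) : ℂ) := by rw [h]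
    push_cast at h'
    linear_combination Complex.I * h'

/-- If (d₁ - d₂)τ = 2πm and (d₂ - d₃)τ = 2πn, the vanishing sum gives 3 d₁ τ = 2π(n + 2m) and 3 d₂ τ
= 2π(n - m), so the ratio is rational. -/
theorem exists_common_period_iff {d₁ d₂ d₃ : ℝ} (hs : d₁ + d₂ + d₃ = 0) (h2 : d₂ ≠ 0) :
    (∃ τ : ℝ, τ ≠ 0 ∧ Complex.exp (Complex.I * d₁ * τ) = Complex.exp (Complex.I * d₂ * τ) ∧
      Complex.exp (Complex.I * d₂ * τ) = Complex.exp (Complex.I * d₃ * τ)) ↔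
      ∃ q : ℚ, d₁ / d₂ = q := by
  have hπ := Real.pi_pos
  simp only [exp_I_mul_eq_iff]
  constructor
  · rintro ⟨τ, hτ, ⟨m, hm⟩, n, hn⟩
    refine ⟨((n + 2 * m : ℤ) : ℚ) / ((n - m : ℤ) : ℚ), ?_⟩
    have e2 : 3 * (d₂ * τ) = (n - m) * (2 * Real.pi) := by
      linear_combination hn - hm + τ * hs
    have e1 : 3 * (d₁ * τ) = (n + 2 * m) * (2 * Real.pi) := by
      linear_combination hn + 2 * hm + τ * hs
    have hnm : (n - m : ℝ) ≠ 0 := by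
      intro h0
      rw [h0, zero_mul] at e2
      have := mul_ne_zero h2 hτ
      apply this; linarith
    push_cast
    rw [div_eq_div_iff h2 hnm]
    have hp : (6 * Real.pi * τ) ≠ 0 := by positivity
    refine mul_left_cancel₀ hp ?_
    linear_combination 2 * Real.pi * (n - m) * e1 - 2 * Real.pi * (n + 2 * m) * e2
  · rintro ⟨q, hq⟩
    have hd : (q.den : ℝ) ≠ 0 := by exact_mod_cast q.den_ne_zero
    have hq' : d₁ * q.den = q.num * d₂ := by
      have : (q : ℝ) = q.num / q.den := by exact_mod_cast (Rat.num_div_den q).symm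
      rw [this] at hq
      rwa [div_eq_div_iff h2 hd] at hq
    -- With this τ, d₁τ and d₂τ are 2π times the numerator and denominator of q, so all three
    -- characters equal 1.
    refine ⟨2 * Real.pi * q.den / d₂, by positivity, ⟨q.num - q.den, ?_⟩, ⟨q.num + 2 * q.den, ?_⟩⟩
    · push_cast
      rw [mul_div_assoc', div_eq_iff h2]
      linear_combination 2 * Real.pi * hq'
    · push_cast
      rw [mul_div_assoc', div_eq_iff h2]
      linear_combination 2 * Real.pi * hq' - 2 * Real.pi * q.den * hs

/-- The conformal factor of an equivariant surface depends on `y` only. -/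
theorem IsTranslationallyEquivariant.metric_invariant {f : ℂ → CP2} {F : ℂ → Fin 3 → ℂ}
    {u : ℂ → ℝ} {φ : ℂ → ℂ} (hequiv : IsTranslationallyEquivariant f) (hF : IsHorizontalLift f F)
    (h : IsMinimalLegendrian F u φ) (t : ℝ) (z : ℂ) : u (t + z) = u z := by
  obtain ⟨R, hR, -, -, hRf⟩ := hequiv
  have h1 := metric_translate_eq hF (hR t) (hRf t) z
  rw [h.metric_z, h.metric_z] at h1
  exact Real.exp_injective (by exact_mod_cast h1)

theorem fderiv_ofReal_apply {u : ℂ → ℝ} {z : ℂ} (hu : DifferentiableAt ℝ u z) (v : ℂ) :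
    fderiv ℝ (fun w => (u w : ℂ)) z v = (fderiv ℝ u z v : ℝ) := by
  have := (Complex.ofRealCLM.hasFDerivAt.comp z hu.hasFDerivAt).fderiv
  erw [this]
  rfl

/-- The Gauss equation as an ordinary differential equation along the imaginary axis. -/
theorem IsMinimalLegendrian.gauss_ode {F : ℂ → Fin 3 → ℂ} {u : ℂ → ℝ} {φ : ℂ → ℂ}
    (h : IsMinimalLegendrian F u φ) (hut : ∀ (t : ℝ) z, u (t + z) = u z) {p : ℝ}
    (hp : ∀ z, ‖φ z‖ = p) :
    ∃ v' : ℝ → ℝ, (∀ y : ℝ, HasDerivAt (fun y : ℝ => u (y * Complex.I)) (v' y) y) ∧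
      ∀ y : ℝ, HasDerivAt v' (4 * (p ^ 2 * Real.exp (-u (y * Complex.I)) ^ 2 -
        Real.exp (u (y * Complex.I)))) y := by
  have hu := h.smooth_u
  have hud := h.diff_u
  have hline : ∀ t : ℝ, HasDerivAt (fun t : ℝ => (t : ℂ) * Complex.I) Complex.I t := fun t => by
    simpa using (Complex.ofRealCLM.hasDerivAt (x := t)).mul_const Complex.I
  have hx : ∀ z, fderiv ℝ u z 1 = 0 := by
    intro z
    have hi : HasDerivAt (fun t : ℝ => (t : ℂ) + z) 1 0 :=
      (Complex.ofRealCLM.hasDerivAt (x := 0)).add_const z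
    have h1 := (hud (((0 : ℝ) : ℂ) + z)).hasFDerivAt.comp_hasDerivAt (0 : ℝ) hi
    rw [Complex.ofReal_zero, zero_add] at h1
    have h2 : HasDerivAt (fun _ : ℝ => u z) 0 0 := hasDerivAt_const _ _
    refine h1.unique ?_
    rw [show (u ∘ fun t : ℝ => (t : ℂ) + z) = fun _ => u z from funext fun t => hut t z]
    exact h2
  have hfy := contDiff_fderiv_apply hu Complex.I
  refine ⟨fun y => fderiv ℝ u (y * Complex.I) Complex.I,
    fun y => (hud _).hasFDerivAt.comp_hasDerivAt y (hline y), fun y => ?_⟩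
  refine ((hfy.differentiable (by simp) _).hasFDerivAt.comp_hasDerivAt y (hline y)).congr_deriv ?_
  -- As u_x = 0, the Laplacian is u_yy, and it equals 4 u_zz̄.
  have h1 := flatLaplacian_eq h.smooth_u_complex (y * Complex.I)
  rw [h.gauss, hp, flatLaplacian,
    show (fun w => fderiv ℝ (fun w => (u w : ℂ)) w 1) = fun _ => 0 from funext fun w => by
      rw [fderiv_ofReal_apply (hud w), hx, Complex.ofReal_zero],
    show (fun w => fderiv ℝ (fun w => (u w : ℂ)) w Complex.I) =
      fun w => ((fderiv ℝ u w Complex.I : ℝ) : ℂ) from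
        funext fun w => fderiv_ofReal_apply (hud w) _,
    fderiv_ofReal_apply (hfy.differentiable (by simp) _)] at h1
  simp only [fderiv_fun_const, Pi.zero_apply, _root_.zero_apply, zero_add, smul_eq_mul] at h1
  exact_mod_cast h1

end MinLag

/-! ### The main theorem. -/

theorem mainTheorem7
    -- the surface, its metric `2 e^u dz dz̄`, and its Hopf differential `-i λ⁻³ ψ dz³`
    (f : ℂ → MinLag.CP2) (u : ℂ → ℝ) (ψ : ℂ → ℂ) (lam : ℂ) (hlam : ‖lam‖ = 1)
    (hf : MinLag.IsConformalMinimalLagrangian f u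
      (fun z => -Complex.I * (lam ^ (-3 : ℤ) * ψ z)))
    (hequiv : MinLag.IsTranslationallyEquivariant f)
    -- not totally geodesic, not flat, the origin is a maximum of the metric
    (hψ : ∃ z, ψ z ≠ 0)
    (hflat : ∃ z, u z ≠ u 0)
    (hmax : ∀ z, u z ≤ u 0)
    -- the cubic form is real
    (hreal : ∀ z, (lam ^ (-3 : ℤ) * ψ z).im = 0)
    -- the constants
    (a₁ a₂ a₃ β k r T P d₁ d₂ d₃ c₁ c₂ c₃ : ℝ)
    (ha₁ : a₁ = Real.exp (u 0))
    (hβ : β = 2 * a₁ + ‖ψ 0‖ ^ 2 / a₁ ^ 2)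
    (ha₂ : a₂ = (β / 2 - a₁ + Real.sqrt ((β / 2 - a₁) ^ 2 + 4 * a₁ * (β / 2 - a₁))) / 2)
    (ha₃ : a₃ = (-(β / 2 - a₁) + Real.sqrt ((β / 2 - a₁) ^ 2 + 4 * a₁ * (β / 2 - a₁))) / 2)
    (hk : k = Real.sqrt ((a₁ - a₂) / (a₁ + a₃)))
    (hr : r = Real.sqrt (2 * (a₁ + a₃)))
    (hT : T = MinLag.ellipticK k / r)
    (hP : P = (lam ^ (-3 : ℤ) * ψ 0).re)
    (hd₁ : d₁ = P / a₁) (hd₂ : d₂ = P / a₂) (hd₃ : d₃ = -P / a₃)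
    (hc₁ : c₁ = a₁ * Real.sqrt ((a₁ - a₂) / (a₁ ^ 3 - ‖ψ 0‖ ^ 2)))
    (hc₂ : c₂ = a₂ * Real.sqrt ((a₁ - a₂) / (‖ψ 0‖ ^ 2 - a₂ ^ 3)))
    (hc₃ : c₃ = a₃ * Real.sqrt ((a₁ + a₃) / (‖ψ 0‖ ^ 2 + a₃ ^ 3))) :
    (∀ z, ψ z = ψ 0) ∧
    -- the canonical horizontal lift exists, has the explicit form, and is `4T`-periodic in `y`
    (∃ F, MinLag.IsCanonicalLift f u ψ lam F) ∧
    (∀ F, MinLag.IsCanonicalLift f u ψ lam F →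
      (∃ l₁ l₂ l₃ : Fin 3 → ℂ,
        MinLag.herm l₁ l₁ = 1 ∧ MinLag.herm l₂ l₂ = 1 ∧ MinLag.herm l₃ l₃ = 1 ∧
        MinLag.herm l₁ l₂ = 0 ∧ MinLag.herm l₁ l₃ = 0 ∧ MinLag.herm l₂ l₃ = 0 ∧
        MinLag.potentialD a₁ (ψ 0) lam *ᵥ l₁ = (Complex.I * d₁) • l₁ ∧
        MinLag.potentialD a₁ (ψ 0) lam *ᵥ l₂ = (Complex.I * d₂) • l₂ ∧
        MinLag.potentialD a₁ (ψ 0) lam *ᵥ l₃ = (Complex.I * d₃) • l₃ ∧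
        ∀ x y : ℝ, F (x + y * Complex.I) =
          (c₁ * MinLag.jacobiSn (r * y) k * Complex.exp (Complex.I * d₁ * x)) • l₁ +
          (c₂ * MinLag.jacobiCn (r * y) k * Complex.exp (Complex.I * d₂ * x)) • l₂ +
          (c₃ * MinLag.jacobiDn (r * y) k * Complex.exp (Complex.I * d₃ * x)) • l₃) ∧
      ∀ x y : ℝ, F (x + (y + 4 * T : ℝ) * Complex.I) = F (x + y * Complex.I)) ∧
    -- the surface is defined on the cylinder `ℂ / 4Tiℤ`
    0 < T ∧
    MinLag.DescendsTo f (AddSubgroup.zmultiples (4 * T * Complex.I : ℂ)) ∧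
    -- consequences of a nonzero real period `τ`
    (∀ τ : ℝ, τ ≠ 0 → (∀ x y : ℝ, f ((x + τ : ℝ) + y * Complex.I) = f (x + y * Complex.I)) →
      Complex.exp (Complex.I * d₁ * τ) = Complex.exp (Complex.I * d₂ * τ) ∧
      Complex.exp (Complex.I * d₂ * τ) = Complex.exp (Complex.I * d₃ * τ) ∧
      LinearIndependent ℝ ![(4 * T * Complex.I : ℂ), (τ : ℂ)] ∧
      MinLag.DescendsTo f (AddSubgroup.zmultiples (4 * T * Complex.I : ℂ) ⊔
        AddSubgroup.zmultiples (τ : ℂ))) ∧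
    -- real periods exist exactly when `d₁ / d₂` is rational
    ((∃ τ : ℝ, τ ≠ 0 ∧ ∀ x y : ℝ, f ((x + τ : ℝ) + y * Complex.I) = f (x + y * Complex.I)) ↔
      ∃ q : ℚ, d₁ / d₂ = q) := by
  obtain ⟨F₀, hF₀, hL⟩ := hf.exists_lift
  have hψc : ∀ z, ψ z = ψ 0 := hL.psi_const hlam hreal
  have hu := hL.smooth_u
  have hut : ∀ (t : ℝ) z, u (t + z) = u z := hequiv.metric_invariant hF₀ hL
  have hp0 : 0 < ‖ψ 0‖ := by
    obtain ⟨z, hz⟩ := hψ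
    rw [hψc z] at hz
    exact norm_pos_iff.2 hz
  obtain ⟨v', hv, hv'⟩ := hL.gauss_ode hut (p := ‖ψ 0‖) fun z => by simp [hlam, hψc z]
  have hvmax : ∀ y : ℝ, u (y * Complex.I) ≤ u (((0 : ℝ) : ℂ) * Complex.I) := fun y => by
    simpa using hmax (y * Complex.I)
  have hv0 : Real.exp (u (((0 : ℝ) : ℂ) * Complex.I)) = a₁ := by rw [ha₁]; simp
  have hlt : ‖ψ 0‖ ^ 2 < a₁ ^ 3 := by
    rw [← hv0]
    refine MinLag.sq_lt_of_nonconstant hv hv' hvmax ?_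
    -- By invariance under real translations, u is already nonconstant on the imaginary axis.
    obtain ⟨z, hz⟩ := hflat
    refine ⟨z.im, ?_⟩
    rw [← Complex.re_add_im z, hut] at hz
    simpa using hz
  have H := MinLag.isRootTriple_of_formula (ha₁ ▸ Real.exp_pos _) hp0 hlt hβ ha₂ ha₃
  have h1 := H.pos₁
  have h2 := H.pos₂
  have h3 := H.pos₃
  have hk2 : k ^ 2 * (a₁ + a₃) = a₁ - a₂ := by
    have : 0 ≤ a₁ - a₂ := by linarith [H.lt]
    rw [hk, Real.sq_sqrt (by positivity)]; field_simp
  have hk1 : k ^ 2 < 1 := by nlinarith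
  have hr2 : r ^ 2 = 2 * (a₁ + a₃) := by rw [hr, Real.sq_sqrt (by positivity)]
  have hr0 : 0 < r := by rw [hr]; exact Real.sqrt_pos.2 (by positivity)
  have hrT : r * (4 * T) = 4 * MinLag.ellipticK k := by rw [hT]; field_simp
  have hT0 : 0 < T := by rw [hT]; exact div_pos (MinLag.ellipticK_pos hk1) hr0
  have hw : ∀ y : ℝ, Real.exp (u (y * Complex.I)) =
      a₁ - (a₁ - a₂) * MinLag.jacobiSn (r * y) k ^ 2 := fun y => by
    have := MinLag.exp_eq_jacobi hv hv' hvmax (a₂ := a₂) (a₃ := a₃) (k := k) (r := r)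
      (hv0 ▸ H) (hv0 ▸ hk2) (hv0 ▸ hr2) y
    rwa [hv0] at this
  have hl0 : lam ≠ 0 := by rintro rfl; simp at hlam
  have hPc : lam ^ (-3 : ℤ) * ψ 0 = P := by
    apply Complex.ext
    · rw [hP, Complex.ofReal_re]
    · rw [hreal 0, Complex.ofReal_im]
  have hPψ : ψ 0 = lam ^ 3 * P := by
    rw [← hPc, ← mul_assoc, show (lam ^ 3 : ℂ) = lam ^ (3 : ℤ) by norm_cast, ← zpow_add₀ hl0]
    simp
  have hPp : P ^ 2 = ‖ψ 0‖ ^ 2 := by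
    rw [hPψ, norm_mul, norm_pow, hlam, Complex.norm_real, one_pow, one_mul, Real.norm_eq_abs, sq_abs]
  have hP0 : P ≠ 0 := by
    rintro rfl
    have : 0 < ‖ψ 0‖ ^ 2 := by positivity
    rw [← hPp] at this
    norm_num at this
  -- The trace of D vanishes; here this is 1/a₁ + 1/a₂ = 1/a₃, a form of a₂a₃ = a₁(a₂ - a₃).
  have hds : d₁ + d₂ + d₃ = 0 := by
    rw [hd₁, hd₂, hd₃]
    field_simp
    linear_combination P * H.mul_eq
  have hd20 : d₂ ≠ 0 := by rw [hd₂]; exact div_ne_zero hP0 h2.ne'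
  have hc₁0 : c₁ ≠ 0 := by
    rw [hc₁, H.coeff₁]; exact (Real.sqrt_pos.2 (by positivity)).ne'
  have hc₂0 : c₂ ≠ 0 := by
    have : 0 < 2 * a₁ - a₃ := by nlinarith [H.mul_eq, H.lt]
    rw [hc₂, H.coeff₂]; exact (Real.sqrt_pos.2 (by positivity)).ne'
  have hc₃0 : c₃ ≠ 0 := by
    rw [hc₃, H.coeff₃]; exact (Real.sqrt_pos.2 (by positivity)).ne'
  have hexplicit : ∀ F, MinLag.IsCanonicalLift f u ψ lam F →
      (∃ l₁ l₂ l₃ : Fin 3 → ℂ,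
        MinLag.herm l₁ l₁ = 1 ∧ MinLag.herm l₂ l₂ = 1 ∧ MinLag.herm l₃ l₃ = 1 ∧
        MinLag.herm l₁ l₂ = 0 ∧ MinLag.herm l₁ l₃ = 0 ∧ MinLag.herm l₂ l₃ = 0 ∧
        MinLag.potentialD a₁ (ψ 0) lam *ᵥ l₁ = (Complex.I * d₁) • l₁ ∧
        MinLag.potentialD a₁ (ψ 0) lam *ᵥ l₂ = (Complex.I * d₂) • l₂ ∧
        MinLag.potentialD a₁ (ψ 0) lam *ᵥ l₃ = (Complex.I * d₃) • l₃ ∧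
        ∀ x y : ℝ, F (x + y * Complex.I) =
          (c₁ * MinLag.jacobiSn (r * y) k * Complex.exp (Complex.I * d₁ * x)) • l₁ +
          (c₂ * MinLag.jacobiCn (r * y) k * Complex.exp (Complex.I * d₂ * x)) • l₂ +
          (c₃ * MinLag.jacobiDn (r * y) k * Complex.exp (Complex.I * d₃ * x)) • l₃) := by
    rintro F ⟨⟨Φ, hΦ, hFΦ⟩, -⟩
    have hF : ∀ z, F z = fun i => Φ z i 2 := fun z => funext (hFΦ z)
    simp only [hF, hc₁, hc₂, hc₃, H.coeff₁, H.coeff₂, H.coeff₃, hd₁, hd₂, hd₃]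
    exact hΦ.explicit_col hlam hu hut hψc hmax ha₁ H hPψ hPp hk2 hr2 hr0 hw
  have hperiodic : ∀ F, MinLag.IsCanonicalLift f u ψ lam F →
      ∀ x y : ℝ, F (x + (y + 4 * T : ℝ) * Complex.I) = F (x + y * Complex.I) := by
    intro F hF x y
    obtain ⟨l₁, l₂, l₃, -, -, -, -, -, -, -, -, -, hform⟩ := hexplicit F hF
    rw [hform, hform, mul_add, hrT, MinLag.jacobiSn_add_period hk1,
      MinLag.jacobiCn_add_period hk1, MinLag.jacobiDn_add_period hk1]
  obtain ⟨F, hF⟩ := hL.exists_canonicalLift hlam hF₀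
  obtain ⟨l₁, l₂, l₃, N1, N2, N3, O12, O13, O23, -, -, -, hform⟩ := hexplicit F hF
  have hT_period : AddSubgroup.zmultiples (4 * T * Complex.I : ℂ) ≤ MinLag.periodSubgroup f := by
    rw [AddSubgroup.zmultiples_le]
    intro z
    refine (hF.eq_iff _ _).2 ⟨1, ?_⟩
    have := hperiodic F hF z.re z.im
    rw [Complex.re_add_im] at this
    rw [one_smul, ← this]
    congr 1
    conv_lhs => rw [← Complex.re_add_im z]
    push_cast; ring
  have hτ_iff : ∀ τ : ℝ, (∀ x y : ℝ, f ((x + τ : ℝ) + y * Complex.I) = f (x + y * Complex.I)) ↔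
      Complex.exp (Complex.I * d₁ * τ) = Complex.exp (Complex.I * d₂ * τ) ∧
      Complex.exp (Complex.I * d₂ * τ) = Complex.exp (Complex.I * d₃ * τ) := by
    intro τ
    constructor
    · intro hper
      -- At y = x₀/r no component of F vanishes, so a scalar relating F(τ, y) to F(0, y) equals each
      -- of the three characters.
      obtain ⟨x₀, hs0, hc0, hd0⟩ := MinLag.exists_jacobi_ne_zero hk1
      obtain ⟨μ, hμ⟩ := (hF.eq_iff _ _).1 (hper 0 (x₀ / r))
      rw [hform, hform, mul_div_cancel₀ _ hr0.ne'] at hμ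
      simp only [Complex.ofReal_zero, mul_zero, Complex.exp_zero, mul_one, zero_add] at hμ
      obtain ⟨e1, e2, e3⟩ := MinLag.eq_of_smul_combination N1 N2 N3 O12 O13 O23
        (mul_ne_zero (Complex.ofReal_ne_zero.2 hc₁0) (Complex.ofReal_ne_zero.2 hs0))
        (mul_ne_zero (Complex.ofReal_ne_zero.2 hc₂0) (Complex.ofReal_ne_zero.2 hc0))
        (mul_ne_zero (Complex.ofReal_ne_zero.2 hc₃0) (Complex.ofReal_ne_zero.2 hd0)) hμ
      exact ⟨e1.trans e2.symm, e2.trans e3.symm⟩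
    · rintro ⟨e1, e2⟩ x y
      -- Any of the three equal characters serves as the scalar.
      refine (hF.eq_iff _ _).2 ⟨Complex.exp (Complex.I * d₃ * τ), ?_⟩
      have hexp : ∀ d : ℝ, Complex.exp (Complex.I * d * (x + τ : ℝ)) =
          Complex.exp (Complex.I * d * x) * Complex.exp (Complex.I * d * τ) := fun d => by
        rw [← Complex.exp_add]; push_cast; ring_nf
      rw [hform, hform, hexp, hexp, hexp, e1, e2]
      simp only [smul_add, smul_smul]
      congr 1
      · congr 1 <;> congr 1 <;> ring
      · congr 1; ring
  refine ⟨hψc, ⟨F, hF⟩, fun G hG => ⟨hexplicit G hG, hperiodic G hG⟩, hT0,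
    MinLag.descendsTo_of_le hT_period, fun τ hτ hper => ?_, ?_⟩
  · refine ⟨((hτ_iff τ).1 hper).1, ((hτ_iff τ).1 hper).2, ?_, ?_⟩
    · rw [LinearIndependent.pair_iff]
      intro s t hst
      have hre := congrArg Complex.re hst
      have him := congrArg Complex.im hst
      simp at hre him
      exact ⟨him.resolve_right hT0.ne', hre.resolve_right hτ⟩
    · refine MinLag.descendsTo_of_le (sup_le hT_period ?_)
      rw [AddSubgroup.zmultiples_le]
      intro z
      have := hper z.re z.im
      rw [Complex.re_add_im] at this
      rw [← this]
      congr 1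
      conv_lhs => rw [← Complex.re_add_im z]
      push_cast; ring
  · simp only [hτ_iff]
    exact MinLag.exists_common_period_iff hds hd20
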